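/- All graphs are finite and simple. A graph is planar if it can be drawn in the plane with distinct points as vertices and simple arcs as edges, such that edges meet vertices and each other only at common endpoints; it is maximal planar if it is planar and no edge can be added between two of its vertices without destroying planarity. A 3-clique is a set of three mutually adjacent vertices. Let $G$ be a maximal planar graph with vertex set $V$. For a 3-clique $k$, consider the two (possibly empty) parts $S,S'$ into which $G$ falls when $k$ is removed: $V\setminus k$ is the disjoint union of $S$ and $S'$, every path from $S$ to $S'$ meets $k$, and both parts are non-empty whenever $k$ is separating (that is, whenever there is such a division with both parts non-empty). The part with fewer vertices is called the interior $G_{in}(k)$ and the other the exterior of $k$; if both have equally many vertices, the choice is arbitrary. Fix such a choice for every 3-clique. All parts are regarded as induced subgraphs, so that inclusion, union and intersection refer to vertex sets. For 3-cliques $k_i,k_j$ write $G^i_{in}=G_{in}(k_i)$ and $G^j_{in}=G_{in}(k_j)$. Theorem. For any two 3-cliques $k_i,k_j$ of $G$: 1. If $k_j\subseteq k_i\cup G^i_{in}$, then $k_j\cup G^j_{in}\subseteq k_i\cup G^i_{in}$; and, with the roles exchanged, if $k_i\subseteq k_j\cup G^j_{in}$, then $k_i\cup G^i_{in}\subseteq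 k_j\cup G^j_{in}$. 2. If neither $k_j\subseteq k_i\cup G^i_{in}$ nor $k_i\subseteq k_j\cup G^j_{in}$, then $G^i_{in}\cap G^j_{in}=\emptyset$. Consequently the interiors form a laminar family: either $k_j\cup G^j_{in}\subseteq k_i\cup G^i_{in}$ and $G^j_{in}\subseteq G^i_{in}$, or $k_i\cup G^i_{in}\subseteq k_j\cup G^j_{in}$ and $G^i_{in}\subseteq G^j_{in}$, or $G^i_{in}\cap G^j_{in}=\emptyset$. -/

import Mathlib

/-- The Euclidean plane. -/
abbrev Plane : Type := EuclideanSpace ℝ (Fin 2)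

/-- A drawing of a simple graph in the plane: distinct vertices are distinct points, every edge `uv`
is a simple arc (the image of an injective continuous path) from the point of `u` to the point
of `v`, an arc contains no vertex other than its two ends, and two different arcs meet at most in
a common end. Only the values of `arc` on edges of `G` matter. -/
structure PlaneDrawing {V : Type*} (G : SimpleGraph V) where
  point : V → Plane
  arc : Sym2 V → Set Plane
  point_injective : Function.Injective point
  arc_spec : ∀ u v : V, G.Adj u v →
    ∃ γ : Path (point u) (point v), Function.Injective γ ∧ Set.range γ = arc s(u, v)
  vertex_on_arc : ∀ e ∈ G.edgeSet, ∀ v : V, point v ∈ arc e → v ∈ e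
  arc_inter_arc : ∀ e ∈ G.edgeSet, ∀ f ∈ G.edgeSet, e ≠ f →
    ∀ x ∈ arc e ∩ arc f, ∃ v : V, v ∈ e ∧ v ∈ f ∧ x = point v

/-- A graph is planar if it can be drawn in the plane. -/
def IsPlanar {V : Type*} (G : SimpleGraph V) : Prop := Nonempty (PlaneDrawing G)

/-- A graph is maximal planar if it is planar and no edge can be inserted (on the same vertex set)
without violating planarity: it is maximal among the planar graphs on `V`. -/
def IsMaximalPlanar {V : Type*} (G : SimpleGraph V) : Prop :=
  Maximal (fun H : SimpleGraph V => IsPlanar H) G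

/-- `S` and `S'` are two parts into which `G` falls when the vertices of `k` are removed: they
partition the remaining vertices, and every walk from `S` to `S'` passes through `k`. (A part is
an induced subgraph and is given by its vertex set; it may be empty.) -/
structure IsDivision {V : Type*} [Fintype V] [DecidableEq V] (G : SimpleGraph V)
    (k S S' : Finset V) : Prop where
  disjoint : Disjoint S S'
  union_eq : S ∪ S' = kᶜ
  walk_meets : ∀ u ∈ S, ∀ v ∈ S', ∀ p : G.Walk u v, ∃ w ∈ p.support, w ∈ k

/-- `k` is separating if it divides `G` into two non-empty parts. -/
def IsSeparating {V : Type*} [Fintype V] [DecidableEq V] (G : SimpleGraph V)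
    (k : Finset V) : Prop :=
  ∃ S S' : Finset V, S.Nonempty ∧ S'.Nonempty ∧ IsDivision G k S S'

/-- `S` is an admissible interior of `k`, with exterior `S'`: these are the two parts into which `k`
divides `G` (both non-empty when `k` is separating, while one of them is empty when it is not), and
the interior is the one of smaller order. If the orders are equal, either part may be taken. -/
structure IsInteriorExterior {V : Type*} [Fintype V] [DecidableEq V] (G : SimpleGraph V)
    (k S S' : Finset V) : Prop where
  division : IsDivision G k S S'
  nonempty_of_separating : IsSeparating G k → S.Nonempty ∧ S'.Nonempty
  card_le : S.card ≤ S'.card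

/-! Two facts about a maximal planar graph carry the proof: no clique with at most two vertices
separates it (`not_isSeparating_of_card_le_two`), and a part cut off by a triangle is connected when
the opposite part is non-empty (`subset_or_subset_of_isDivision`).

Let `ki ≠ kj` have interiors `S`, `T` and exteriors `S'`, `T'`. If `kj ⊆ ki ∪ S`, then `S'` avoids
`kj` and is connected, so it lies in one part `X` of `kj`. Also `ki \ kj ⊆ X`, since otherwise the
at most two vertices of `ki ∩ kj` would cut off `S'`. Hence the other part of `kj` lies in `S`, and
`S'` is strictly smaller than `X`. Comparing orders, `X` must be `T'`, so `T ⊆ S`. If neither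
triangle lies in the other's closed interior, each has a vertex in the other's exterior and, being a
clique, none in the other's interior. Interiors that meet then coincide by connectedness, and `ki ∩
kj` cuts off the common interior.

The first fact is topological. A clique with at most two vertices is drawn as nothing, a point or an
arc, so its complement is connected and some face touches both sides. Janiszewski's theorem shows
that a face touching the inside of an edge also touches its ends, so this face has a vertex of each
side on its boundary and admits a new edge. For the second fact, three parts cut off by a triangle
would yield a drawing of `K₃,₃`. Janiszewski's theorem and the exclusion of `K₃,₃` both rest on
continuous complex logarithms. -/

section PlaneTopology

open Set Filter Topology Metric unitInterval

/-! ### Continuous logarithms, Eilenberg's criterion and Janiszewski's theorem -/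

/-- `f` has a continuous logarithm on `X`. -/
def HasLogOn {A : Type*} [TopologicalSpace A] (f : A → ℂ) (X : Set A) : Prop :=
  ∃ g : A → ℂ, ContinuousOn g X ∧ ∀ z ∈ X, Complex.exp (g z) = f z

/-- A real normed space is simply connected and locally path connected, so `f` lifts through the
covering `exp`. -/
theorem exists_continuous_log {E : Type*} [NormedAddCommGroup E] [NormedSpace ℝ E] {f : E → ℂ}
    (hf : Continuous f) (h0 : ∀ x, f x ≠ 0) :
    ∃ g : E → ℂ, Continuous g ∧ ∀ x, Complex.exp (g x) = f x := by
  obtain ⟨g, ⟨-, hg⟩, -⟩ := Complex.isCoveringMapOn_exp.existsUnique_continuousMap_lifts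
    (⟨f, hf⟩ : C(E, ℂ)) (a₀ := 0) (Complex.exp_log (h0 0)) (fun x => h0 x)
  exact ⟨g, g.continuous, fun x => congrFun hg x⟩

namespace HasLogOn

variable {A : Type*} [TopologicalSpace A] {f g : A → ℂ} {X Y : Set A}

theorem congr (h : HasLogOn f X) (hfg : ∀ z ∈ X, f z = g z) : HasLogOn g X := by
  obtain ⟨l, hl, hl'⟩ := h
  exact ⟨l, hl, fun z hz => (hl' z hz).trans (hfg z hz)⟩

theorem mul (hf : HasLogOn f X) (hg : HasLogOn g X) : HasLogOn (fun z => f z * g z) X := by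
  obtain ⟨l, hl, hl'⟩ := hf
  obtain ⟨m, hm, hm'⟩ := hg
  exact ⟨fun z => l z + m z, hl.add hm, fun z hz => by rw [Complex.exp_add, hl' z hz, hm' z hz]⟩

theorem inv (hf : HasLogOn f X) : HasLogOn (fun z => (f z)⁻¹) X := by
  obtain ⟨l, hl, hl'⟩ := hf
  exact ⟨fun z => - l z, hl.neg, fun z hz => by rw [Complex.exp_neg, hl' z hz]⟩

theorem of_slitPlane (hf : ContinuousOn f X) (h : ∀ z ∈ X, f z ∈ Complex.slitPlane) :
    HasLogOn f X :=
  ⟨fun z => Complex.log (f z), hf.clog h, fun z hz =>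
    Complex.exp_log (Complex.slitPlane_ne_zero (h z hz))⟩

/-- Logarithms on two closed sets with at most one common point can be glued. -/
theorem union {c : A} (hX : IsClosed X) (hY : IsClosed Y) (hXY : X ∩ Y ⊆ {c})
    (h1 : HasLogOn f X) (h2 : HasLogOn f Y) : HasLogOn f (X ∪ Y) := by
  classical
  obtain ⟨l, hl, hl'⟩ := h1
  obtain ⟨m, hm, hm'⟩ := h2
  -- At the common point the two logarithms differ by a period `d` of `exp`; if there is none, `d =
  -- 0` serves.
  obtain ⟨d, hd, hd'⟩ : ∃ d : ℂ, Complex.exp d = 1 ∧ ∀ z ∈ X ∩ Y, l z = m z + d := by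
    by_cases hc : c ∈ X ∩ Y
    · refine ⟨l c - m c, ?_, ?_⟩
      · rw [Complex.exp_sub, hl' c hc.1, hm' c hc.2, div_self]
        rw [← hl' c hc.1]; exact Complex.exp_ne_zero _
      · intro z hz
        rw [hXY hz]; ring
    · exact ⟨0, by simp, fun z hz => absurd (hXY hz ▸ hz : c ∈ X ∩ Y) hc⟩
  have hglue : ∀ z ∈ Y, (if z ∈ X then l z else m z + d) = m z + d := by
    intro z hz
    split_ifs with hzX
    · exact hd' z ⟨hzX, hz⟩
    · rfl
  refine ⟨fun z => if z ∈ X then l z else m z + d, ?_, ?_⟩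
  · refine ContinuousOn.union_of_isClosed ?_ ?_ hX hY
    · exact hl.congr fun z hz => if_pos hz
    · exact (hm.add continuousOn_const).congr hglue
  · rintro z (hz | hz)
    · simp only [if_pos hz]; exact hl' z hz
    · simp only [hglue z hz]; rw [Complex.exp_add, hd, mul_one, hm' z hz]

end HasLogOn

/-- The function is pulled back to `ℝ` along the extended path and lifted there; an injective path
is an embedding, so the logarithm can be carried back to the arc. -/
theorem hasLogOn_range_of_injective {A : Type*} [TopologicalSpace A] [T2Space A] {x y : A}
    (γ : Path x y) (hγ : Function.Injective γ)
    {f : A → ℂ} (hf : ContinuousOn f (range γ)) (h0 : ∀ z ∈ range γ, f z ≠ 0) :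
    HasLogOn f (range γ) := by
  have hc : Continuous fun t : ℝ => f (γ.extend t) := by
    refine hf.comp_continuous γ.continuous_extend fun t => ?_
    rw [← γ.extend_range]; exact mem_range_self t
  obtain ⟨g, hg, hg'⟩ := exists_continuous_log hc fun t => h0 _ (by
    rw [← γ.extend_range]; exact mem_range_self t)
  have he : IsClosedEmbedding γ := γ.continuous.isClosedEmbedding hγ
  let e := he.isEmbedding.toHomeomorph
  classical
  refine ⟨fun z => if h : z ∈ range γ then g (e.symm ⟨z, h⟩) else 0, ?_, ?_⟩
  · rw [continuousOn_iff_continuous_domRestrict]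
    have : Continuous fun z : range γ => g (e.symm z) := by fun_prop
    convert this using 1
    ext z
    exact dif_pos z.2
  · rintro _ ⟨t, rfl⟩
    have : e.symm ⟨γ t, mem_range_self t⟩ = t := e.symm_apply_eq.2 rfl
    simp only [mem_range_self, dif_pos, this]
    rw [hg', Path.extend_apply _ t.2]

/-- On the circle `1 - p / z` stays in the slit plane, which reduces the claim to `p = 0`. A
logarithm along `R * exp (θ * I)`, minus `θ * I`, would lift the constant `R` and so be constant;
comparing `0` with `2π` gives `2πi = 0`. -/
theorem not_hasLogOn_sphere {R : ℝ} {p : ℂ} (hp : ‖p‖ < R) :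
    ¬ HasLogOn (fun z => z - p) (sphere (0 : ℂ) R) := by
  intro h
  have hR : 0 < R := (norm_nonneg p).trans_lt hp
  have hz0 : ∀ z ∈ sphere (0 : ℂ) R, z ≠ 0 := by
    rintro z hz rfl
    simp at hz; exact hR.ne hz
  have h1 : HasLogOn (fun z => 1 - p / z) (sphere (0 : ℂ) R) := by
    refine HasLogOn.of_slitPlane ?_ ?_
    · exact continuousOn_const.sub (continuousOn_const.div continuousOn_id hz0)
    · intro z hz
      rw [sub_eq_add_neg]
      refine Complex.mem_slitPlane_of_norm_lt_one ?_
      rw [norm_neg, norm_div, mem_sphere_zero_iff_norm.1 hz, div_lt_one hR]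
      exact hp
  obtain ⟨l, hl, hl'⟩ : HasLogOn (fun z => z) (sphere (0 : ℂ) R) := by
    refine (h.mul h1.inv).congr fun z hz => ?_
    have hzp : z - p ≠ 0 := by
      intro h
      rw [← sub_eq_zero.1 h, mem_sphere_zero_iff_norm.1 hz] at hp
      exact lt_irrefl _ hp
    have := hz0 z hz
    have h3 : 1 - p / z = (z - p) / z := by field_simp
    simp only [h3]
    field_simp
  have hmem : ∀ θ : ℝ, (R : ℂ) * Complex.exp (θ * Complex.I) ∈ sphere (0 : ℂ) R := by
    intro θ
    rw [mem_sphere_zero_iff_norm, norm_mul, Complex.norm_exp_ofReal_mul_I, mul_one,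
      Complex.norm_real, Real.norm_of_nonneg hR.le]
  let m : ℝ → ℂ := fun θ => l (R * Complex.exp (θ * Complex.I)) - θ * Complex.I
  have hm : Continuous m := by
    refine Continuous.sub (hl.comp_continuous (by fun_prop) hmem) (by fun_prop)
  have hme : ∀ θ, Complex.exp (m θ) = R := by
    intro θ
    simp only [m]
    rw [Complex.exp_sub, hl' _ (hmem θ), mul_div_assoc, div_self (Complex.exp_ne_zero _), mul_one]
  have hconst := Complex.isCoveringMap_exp.eq_of_comp_eq (A := ℝ) (g₁ := m) (g₂ := fun _ => m 0)
    hm continuous_const (by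
      ext θ
      simp [hme]) 0 rfl
  have h2 := congrFun hconst (2 * Real.pi)
  simp only [m] at h2
  have e1 : Complex.exp (((2 * Real.pi : ℝ) : ℂ) * Complex.I) = 1 := by
    push_cast; exact Complex.exp_two_pi_mul_I
  rw [e1] at h2
  simp only [Complex.ofReal_zero, zero_mul, Complex.exp_zero, sub_zero] at h2
  have h3 : ((2 * Real.pi : ℝ) : ℂ) * Complex.I = 0 := by linear_combination -h2
  simp [Real.pi_ne_zero] at h3

/-- The existence of the logarithm is an equivalence relation in `p` and `q`. It holds locally,
because `(z - y) / (z - x) = 1 + (x - y) / (z - x)` stays within distance less than `1` of `1` for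
`y` near `x`; hence it holds along a path. -/
theorem hasLogOn_of_joinedIn {X : Set ℂ} (hX : IsClosed X) {p q : ℂ} (h : JoinedIn Xᶜ p q) :
    HasLogOn (fun z => (z - p) / (z - q)) X := by
  obtain ⟨γ, hγ⟩ := h
  have hs : range γ ⊆ Xᶜ := by rintro _ ⟨t, rfl⟩; exact hγ t
  have hne : ∀ x ∈ range γ, ∀ z ∈ X, z - x ≠ 0 := by
    intro x hx z hz h
    rw [sub_eq_zero.1 h] at hz
    exact hs hx hz
  refine (isPreconnected_range γ.continuous).induction₂
    (fun x y => HasLogOn (fun z => (z - x) / (z - y)) X) ?_ ?_ ?_ ⟨0, γ.source⟩ ⟨1, γ.target⟩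
  · intro x hx
    obtain ⟨ε, hε, hball⟩ := Metric.isOpen_iff.1 hX.isOpen_compl x (hs hx)
    have : ∀ᶠ y in 𝓝[range γ] x, dist y x < ε :=
      mem_nhdsWithin_of_mem_nhds (Metric.ball_mem_nhds x hε)
    filter_upwards [this, self_mem_nhdsWithin] with y hy hyγ
    have h1 : HasLogOn (fun z => 1 + (x - y) / (z - x)) X := by
      refine HasLogOn.of_slitPlane ?_ ?_
      · exact continuousOn_const.add (continuousOn_const.div
          (continuousOn_id.sub continuousOn_const) (hne x hx))
      · intro z hz
        refine Complex.mem_slitPlane_of_norm_lt_one ?_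
        have hzx : ε ≤ ‖z - x‖ := by
          rw [← dist_eq_norm]
          by_contra hlt
          exact hball (mem_ball.2 (not_le.1 hlt)) hz
        rw [norm_div, div_lt_one (hε.trans_le hzx), ← dist_eq_norm, dist_comm]
        exact hy.trans_le hzx
    refine h1.inv.congr fun z hz => ?_
    have hx' := hne x hx z hz
    have hy' := hne y hyγ z hz
    have h3 : 1 + (x - y) / (z - x) = (z - y) / (z - x) := by field_simp; ring
    simp only [h3]
    rw [inv_div]
  · intro x y z hx hy hz h1 h2
    refine (h1.mul h2).congr fun w hw => ?_
    have := hne y hy w hw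
    have := hne z hz w hw
    field_simp
  · intro x y hx hy h
    refine h.inv.congr fun w hw => ?_
    rw [inv_div]

/-- Extend the logarithm to the plane by Tietze. Replacing `z - p` inside `U` by `exp (G z) * (z -
q)` gives a continuous function `k` without zeros, which has a global logarithm. But `k` is still `z
- p` on a large circle. -/
theorem not_hasLogOn_of_isBounded_component {X U : Set ℂ} (hX : IsClosed X)
    (hb : Bornology.IsBounded U) (hfr : frontier U ⊆ X) {p q : ℂ} (hp : p ∈ U) (hq : q ∉ U)
    (hqX : q ∉ X) : ¬ HasLogOn (fun z => (z - p) / (z - q)) X := by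
  classical
  rintro ⟨g, hg, hg'⟩
  obtain ⟨G, hG⟩ := ContinuousMap.exists_restrict_eq hX
    (⟨X.domRestrict g, continuousOn_iff_continuous_domRestrict.1 hg⟩ : C(X, ℂ))
  have hG' : ∀ z ∈ X, G z = g z := fun z hz => DFunLike.congr_fun hG (⟨z, hz⟩ : X)
  let k : ℂ → ℂ := U.piecewise (fun z => Complex.exp (G z) * (z - q)) (fun z => z - p)
  have hk : Continuous k := by
    refine Continuous.piecewise ?_ (by fun_prop) (by fun_prop)
    intro z hz
    have hzX := hfr hz
    have hzq : z - q ≠ 0 := fun h => hqX (sub_eq_zero.1 h ▸ hzX)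
    rw [hG' z hzX, hg' z hzX, div_mul_cancel₀ _ hzq]
  have hk0 : ∀ z, k z ≠ 0 := by
    intro z
    by_cases hz : z ∈ U
    · simp only [k, piecewise_eq_of_mem _ _ _ hz]
      refine mul_ne_zero (Complex.exp_ne_zero _) fun h => hq ?_
      rw [← sub_eq_zero.1 h]; exact hz
    · simp only [k, piecewise_eq_of_notMem _ _ _ hz]
      exact fun h => hz (sub_eq_zero.1 h ▸ hp)
  obtain ⟨l, hl, hl'⟩ := exists_continuous_log hk hk0
  obtain ⟨R, hR⟩ := hb.subset_ball (0 : ℂ)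
  have hpR := hR hp
  rw [mem_ball_zero_iff] at hpR
  refine not_hasLogOn_sphere hpR ⟨l, hl.continuousOn, fun z hz => ?_⟩
  rw [hl']
  refine piecewise_eq_of_notMem _ _ _ fun hzU => ?_
  have := hR hzU
  rw [mem_ball_zero_iff, mem_sphere_zero_iff_norm.1 hz] at this
  exact lt_irrefl _ this

theorem frontier_connectedComponentIn_subset {E : Type*} [TopologicalSpace E]
    [LocallyConnectedSpace E] {X : Set E} (hX : IsClosed X) (p : E) :
    frontier (connectedComponentIn Xᶜ p) ⊆ X := by
  intro z hz
  by_contra hzX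
  have hUo : IsOpen (connectedComponentIn Xᶜ p) := hX.isOpen_compl.connectedComponentIn
  have hVo : IsOpen (connectedComponentIn Xᶜ z) := hX.isOpen_compl.connectedComponentIn
  obtain ⟨w, hwV, hwU⟩ := mem_closure_iff.1 hz.1 _ hVo (mem_connectedComponentIn hzX)
  refine hz.2 ?_
  rw [hUo.interior_eq, connectedComponentIn_eq hwU, ← connectedComponentIn_eq hwV]
  exact mem_connectedComponentIn hzX

theorem isPreconnected_compl_closedBall (R : ℝ) : IsPreconnected (closedBall (0 : ℂ) R)ᶜ := by
  rcases lt_or_ge R 0 with hR | hR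
  · rw [closedBall_eq_empty.2 hR, compl_empty]
    exact isPreconnected_univ
  have : (closedBall (0 : ℂ) R)ᶜ =
      (fun x : ℝ × ℝ => (x.1 : ℂ) * Complex.exp (x.2 * Complex.I)) '' (Ioi R ×ˢ univ) := by
    ext z
    simp only [mem_compl_iff, mem_closedBall_zero_iff, not_le, mem_image, mem_prod, mem_Ioi,
      mem_univ, and_true, Prod.exists]
    constructor
    · intro h
      exact ⟨‖z‖, z.arg, h, Complex.norm_mul_exp_arg_mul_I z⟩
    · rintro ⟨r, θ, hr, rfl⟩
      rw [norm_mul, Complex.norm_exp_ofReal_mul_I, mul_one, Complex.norm_real,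
        Real.norm_of_nonneg (hR.trans hr.le)]
      exact hr
  rw [this]
  exact (isPreconnected_Ioi.prod isPreconnected_univ).image _ (by fun_prop)

/-- **Eilenberg's criterion**: two points are in the same component of the complement of a compact
set `X` if the quotient of the distances to them has a continuous logarithm on `X`. -/
theorem joinedIn_of_hasLogOn {X : Set ℂ} (hX : IsCompact X) {p q : ℂ} (hp : p ∉ X) (hq : q ∉ X)
    (h : HasLogOn (fun z => (z - p) / (z - q)) X) : JoinedIn Xᶜ p q := by
  have hXo := hX.isClosed.isOpen_compl
  have hoU : ∀ z, IsOpen (connectedComponentIn Xᶜ z) := fun z => hXo.connectedComponentIn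
  by_cases hpq : q ∈ connectedComponentIn Xᶜ p
  · have hc : IsConnected (connectedComponentIn Xᶜ p) :=
      isConnected_connectedComponentIn_iff.2 hp
    exact (((hoU p).isConnected_iff_isPathConnected.1 hc).joinedIn p
      (mem_connectedComponentIn hp) q hpq).mono (connectedComponentIn_subset _ _)
  exfalso
  have hqp : p ∉ connectedComponentIn Xᶜ q := by
    intro h'
    refine hpq ?_
    rw [← connectedComponentIn_eq h']
    exact mem_connectedComponentIn hq
  by_cases hbp : Bornology.IsBounded (connectedComponentIn Xᶜ p)
  · exact not_hasLogOn_of_isBounded_component hX.isClosed hbp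
      (frontier_connectedComponentIn_subset hX.isClosed p) (mem_connectedComponentIn hp) hpq hq h
  by_cases hbq : Bornology.IsBounded (connectedComponentIn Xᶜ q)
  · refine not_hasLogOn_of_isBounded_component hX.isClosed hbq
      (frontier_connectedComponentIn_subset hX.isClosed q) (mem_connectedComponentIn hq) hqp hp
      (h.inv.congr fun z hz => ?_)
    rw [inv_div]
  -- Two unbounded components both reach beyond a disc containing `X`; the outside of the disc is
  -- connected, so they coincide.
  obtain ⟨R, hR⟩ := hX.isBounded.subset_closedBall (0 : ℂ)
  have hmeet : ∀ z, ¬ Bornology.IsBounded (connectedComponentIn Xᶜ z) →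
      ∃ w ∈ connectedComponentIn Xᶜ z, w ∈ (closedBall (0 : ℂ) R)ᶜ := by
    intro z hz
    by_contra! hcon
    exact hz (isBounded_closedBall.subset fun w hw => not_not.1 (hcon w hw))
  obtain ⟨w, hw, hwR⟩ := hmeet p hbp
  obtain ⟨w', hw', hwR'⟩ := hmeet q hbq
  have hsub : (closedBall (0 : ℂ) R)ᶜ ⊆ connectedComponentIn Xᶜ w :=
    (isPreconnected_compl_closedBall R).subset_connectedComponentIn hwR (compl_subset_compl.2 hR)
  apply hpq
  rw [connectedComponentIn_eq hw, connectedComponentIn_eq (hsub hwR'), ← connectedComponentIn_eq hw']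
  exact mem_connectedComponentIn hq

/-- **Janiszewski's theorem** for two compact sets with at most one common point. -/
theorem joinedIn_compl_union_complex {X Y : Set ℂ} {c p q : ℂ} (hX : IsCompact X)
    (hY : IsCompact Y) (hXY : X ∩ Y ⊆ {c}) (h1 : JoinedIn Xᶜ p q) (h2 : JoinedIn Yᶜ p q) :
    JoinedIn (X ∪ Y)ᶜ p q := by
  refine joinedIn_of_hasLogOn (hX.union hY) ?_ ?_
    ((hasLogOn_of_joinedIn hX.isClosed h1).union hX.isClosed hY.isClosed hXY
      (hasLogOn_of_joinedIn hY.isClosed h2))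
  · rintro (h | h)
    exacts [h1.source_mem h, h2.source_mem h]
  · rintro (h | h)
    exacts [h1.target_mem h, h2.target_mem h]

theorem joinedIn_compl_range_complex {x y p q : ℂ} (γ : Path x y) (hγ : Function.Injective γ)
    (hp : p ∉ range γ) (hq : q ∉ range γ) : JoinedIn (range γ)ᶜ p q := by
  have hne : ∀ x ∉ range γ, ∀ z ∈ range γ, z - x ≠ 0 :=
    fun x hx z hz h => hx (sub_eq_zero.1 h ▸ hz)
  refine joinedIn_of_hasLogOn (isCompact_range γ.continuous) hp hq
    (hasLogOn_range_of_injective γ hγ ?_ ?_)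
  · exact (continuousOn_id.sub continuousOn_const).div (continuousOn_id.sub continuousOn_const)
      (hne q hq)
  · intro z hz
    exact div_ne_zero (hne p hp z hz) (hne q hq z hz)

/-- The identification of the Euclidean plane with the complex plane. -/
noncomputable def planeHomeomorph : Plane ≃ₜ ℂ :=
  Complex.orthonormalBasisOneI.repr.symm.toHomeomorph

theorem joinedIn_image_homeomorph {A B : Type*} [TopologicalSpace A] [TopologicalSpace B]
    (e : A ≃ₜ B) {X : Set A} {p q : A} : JoinedIn (e '' X)ᶜ (e p) (e q) ↔ JoinedIn Xᶜ p q := by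
  constructor
  · intro h
    have := h.map e.symm.continuous
    rwa [e.symm_apply_apply, e.symm_apply_apply, ← e.image_compl, ← image_comp,
      e.symm_comp_self, image_id] at this
  · intro h
    have := h.map e.continuous
    rwa [e.image_compl] at this

/-- **Janiszewski's theorem** for two compact sets with at most one common point. -/
theorem joinedIn_compl_union {X Y : Set Plane} {c p q : Plane} (hX : IsCompact X)
    (hY : IsCompact Y) (hXY : X ∩ Y ⊆ {c}) (h1 : JoinedIn Xᶜ p q) (h2 : JoinedIn Yᶜ p q) :
    JoinedIn (X ∪ Y)ᶜ p q := by
  let e := planeHomeomorph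
  rw [← joinedIn_image_homeomorph e] at h1 h2 ⊢
  rw [image_union]
  refine joinedIn_compl_union_complex (c := e c) (hX.image e.continuous) (hY.image e.continuous)
    ?_ h1 h2
  rw [← image_inter e.injective, ← image_singleton]
  exact image_mono hXY

/-- An arc does not separate the plane. -/
theorem joinedIn_compl_range {x y p q : Plane} (γ : Path x y) (hγ : Function.Injective γ)
    (hp : p ∉ range γ) (hq : q ∉ range γ) : JoinedIn (range γ)ᶜ p q := by
  let e := planeHomeomorph
  have hr : range (γ.map e.continuous) = e '' range γ := by
    rw [← range_comp]; rfl
  rw [← joinedIn_image_homeomorph e, ← hr]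
  refine joinedIn_compl_range_complex _ (e.injective.comp hγ) ?_ ?_
  · rw [hr, e.injective.mem_set_image]; exact hp
  · rw [hr, e.injective.mem_set_image]; exact hq

/-! ### Change of the logarithm along paths, and `K₃,₃` -/

theorem log_sub_log_eq {l m : ℝ → ℂ} (hl : Continuous l) (hm : Continuous m)
    (h : ∀ t, Complex.exp (l t) = Complex.exp (m t)) (s t : ℝ) : l s - l t = m s - m t := by
  have hconst := Complex.isCoveringMap_exp.eq_of_comp_eq (A := ℝ) (g₁ := fun s => l s - m s)
    (g₂ := fun _ => l t - m t) (hl.sub hm) continuous_const (by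
      ext s
      simp [Complex.exp_sub, h]) t rfl
  have := congrFun hconst s
  linear_combination this

/-- The change of the logarithm of `γ - p` along the path `γ`. -/
def IsLogChange {x y : ℂ} (γ : Path x y) (p θ : ℂ) : Prop :=
  ∃ l : ℝ → ℂ, Continuous l ∧ (∀ t, Complex.exp (l t) = γ.extend t - p) ∧ θ = l 1 - l 0

namespace IsLogChange

variable {x y x' y' p θ θ' : ℂ} {γ : Path x y} {γ' : Path x' y'}

theorem unique (h : IsLogChange γ p θ) (h' : IsLogChange γ p θ') : θ = θ' := by
  obtain ⟨l, hl, hl', rfl⟩ := h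
  obtain ⟨m, hm, hm', rfl⟩ := h'
  exact log_sub_log_eq hl hm (fun t => (hl' t).trans (hm' t).symm) _ _

theorem exp_eq (h : IsLogChange γ p θ) (φ ψ : ℂ) (hφ : Complex.exp φ = x - p)
    (hψ : Complex.exp ψ = y - p) : ∃ n : ℤ, θ = ψ - φ + n * (2 * Real.pi * Complex.I) := by
  obtain ⟨l, hl, hl', rfl⟩ := h
  rw [← Complex.exp_eq_exp_iff_exists_int, Complex.exp_sub, Complex.exp_sub, hl', hl', hφ, hψ]
  simp

end IsLogChange

/-- For two disjoint paths, the changes of the logarithm of the difference along the four sides of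
the parameter square add up to zero. -/
theorem exists_isLogChange_of_disjoint {x y x' y' : ℂ} (γ : Path x y) (γ' : Path x' y')
    (h : Disjoint (range γ) (range γ')) :
    ∃ a b c d : ℂ, IsLogChange γ x' a ∧ IsLogChange γ y' b ∧ IsLogChange γ' x c ∧
      IsLogChange γ' y d ∧ a + d - b - c = 0 := by
  obtain ⟨L, hL, hL'⟩ := exists_continuous_log
    (f := fun z : ℝ × ℝ => γ.extend z.1 - γ'.extend z.2) (by fun_prop) (by
      intro z hz
      rw [← γ.extend_range, ← γ'.extend_range] at h
      exact Set.disjoint_left.1 h (mem_range_self z.1) (sub_eq_zero.1 hz ▸ mem_range_self z.2))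
  -- Along `γ'` the difference has the opposite sign; the constant `πi` corrects this and cancels in
  -- the change.
  have hneg : ∀ z, Complex.exp (L z + Real.pi * Complex.I) = γ'.extend z.2 - γ.extend z.1 := by
    intro z
    rw [Complex.exp_add, Complex.exp_pi_mul_I, hL']; ring
  refine ⟨_, _, _, _, ⟨fun s => L (s, 0), by fun_prop, fun s => ?_, rfl⟩,
    ⟨fun s => L (s, 1), by fun_prop, fun s => ?_, rfl⟩,
    ⟨fun t => L (0, t) + Real.pi * Complex.I, by fun_prop, fun t => ?_, rfl⟩,
    ⟨fun t => L (1, t) + Real.pi * Complex.I, by fun_prop, fun t => ?_, rfl⟩, ?_⟩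
  · rw [hL']; simp
  · rw [hL']; simp
  · rw [hneg]; simp
  · rw [hneg]; simp
  · ring

/-- The complete bipartite graph `K₃,₃` has no drawing in which any two independent edges are
disjoint. -/
theorem not_exists_weak_drawing_K33_complex (a b : Fin 3 → ℂ) (γ : ∀ i j, Path (a i) (b j))
    (h : ∀ i k j l, i ≠ k → j ≠ l → Disjoint (range (γ i j)) (range (γ k l))) : False := by
  have haa : ∀ i k, i ≠ k → a i - a k ≠ 0 := fun i k hik h0 =>
    Set.disjoint_left.1 (h i k 0 1 hik (by decide)) ⟨0, (γ i 0).source⟩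
      ⟨0, (γ k 1).source.trans (sub_eq_zero.1 h0).symm⟩
  have hbb : ∀ j l, j ≠ l → b j - b l ≠ 0 := fun j l hjl h0 =>
    Set.disjoint_left.1 (h 0 1 j l (by decide) hjl) ⟨1, (γ 0 j).target⟩
      ⟨1, (γ 1 l).target.trans (sub_eq_zero.1 h0).symm⟩
  have hab : ∀ i j, a i - b j ≠ 0 := by
    intro i j h0
    obtain ⟨k, hk⟩ : ∃ k, i ≠ k := ⟨i + 1, by fin_cases i <;> decide⟩
    obtain ⟨l, hl⟩ : ∃ l, l ≠ j := ⟨j + 1, by fin_cases j <;> decide⟩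
    exact Set.disjoint_left.1 (h i k l j hk hl) ⟨0, (γ i l).source⟩
      ⟨1, (γ k j).target.trans (sub_eq_zero.1 h0).symm⟩
  let P : ℂ := Real.pi * Complex.I
  have hP : Complex.exp P = -1 := Complex.exp_pi_mul_I
  -- Fixed logarithms of all differences of vertices, with `A k i = A i k + P` for `i < k` and
  -- likewise for `B`. Each change of logarithm is then determined up to an integer multiple of `2 *
  -- P`.
  let A : Fin 3 → Fin 3 → ℂ := fun i k =>
    if i < k then Complex.log (a i - a k) else Complex.log (a k - a i) + P
  let B : Fin 3 → Fin 3 → ℂ := fun j l =>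
    if j < l then Complex.log (b j - b l) else Complex.log (b l - b j) + P
  let C : Fin 3 → Fin 3 → ℂ := fun i j => Complex.log (a i - b j)
  have hA : ∀ i k, i ≠ k → Complex.exp (A i k) = a i - a k := by
    intro i k hik
    simp only [A]
    split_ifs
    · rw [Complex.exp_log (haa i k hik)]
    · rw [Complex.exp_add, Complex.exp_log (haa k i hik.symm), hP]; ring
  have hB : ∀ j l, j ≠ l → Complex.exp (B j l) = b j - b l := by
    intro j l hjl
    simp only [B]
    split_ifs
    · rw [Complex.exp_log (hbb j l hjl)]
    · rw [Complex.exp_add, Complex.exp_log (hbb l j hjl.symm), hP]; ring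
  have hC : ∀ i j, Complex.exp (C i j) = a i - b j := fun i j => Complex.exp_log (hab i j)
  have hC' : ∀ i j, Complex.exp (C i j + P) = b j - a i := fun i j => by
    rw [Complex.exp_add, hC, hP]; ring
  -- Stated for all triples to make `n` a total function; `0` is the default when `i = k` or no
  -- change of logarithm exists.
  have hn : ∀ i j k, ∃ n : ℤ, ∀ θ, i ≠ k → IsLogChange (γ i j) (a k) θ →
      θ = (C k j + P) - A i k + n * (2 * P) := by
    intro i j k
    by_cases hex : ∃ θ, i ≠ k ∧ IsLogChange (γ i j) (a k) θ
    · obtain ⟨θ, hik, hθ⟩ := hex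
      obtain ⟨n, hn⟩ := hθ.exp_eq (A i k) (C k j + P) (hA i k hik) (hC' k j)
      refine ⟨n, fun θ' _ hθ' => ?_⟩
      rw [hθ'.unique hθ, hn]; simp only [P]; ring
    · exact ⟨0, fun θ hik hθ => absurd ⟨θ, hik, hθ⟩ hex⟩
  have hm : ∀ i j l, ∃ n : ℤ, ∀ θ, j ≠ l → IsLogChange (γ i j) (b l) θ →
      θ = B j l - C i l + n * (2 * P) := by
    intro i j l
    by_cases hex : ∃ θ, j ≠ l ∧ IsLogChange (γ i j) (b l) θ
    · obtain ⟨θ, hjl, hθ⟩ := hex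
      obtain ⟨n, hn⟩ := hθ.exp_eq (C i l) (B j l) (hC i l) (hB j l hjl)
      refine ⟨n, fun θ' _ hθ' => ?_⟩
      rw [hθ'.unique hθ, hn]; simp only [P]; ring
    · exact ⟨0, fun θ hjl hθ => absurd ⟨θ, hjl, hθ⟩ hex⟩
  choose n hn using hn
  choose m hm using hm
  have hP0 : (2 * P) ≠ 0 := by simp [P, Real.pi_ne_zero]
  have key : ∀ i k j l, i < k → j ≠ l →
      n i j k - m i j l + m k l j - n k l i + (if j < l then 1 else 0) = 0 := by
    intro i k j l hik hjl
    obtain ⟨α, β, χ, δ, h1, h2, h3, h4, h5⟩ :=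
      exists_isLogChange_of_disjoint (γ i j) (γ k l) (h i k j l hik.ne hjl)
    rw [hn i j k α hik.ne h1, hm i j l β hjl h2, hn k l i χ hik.ne' h3, hm k l j δ hjl.symm h4]
      at h5
    have e1 : A k i = A i k + P := by simp only [A, if_pos hik, if_neg hik.not_gt]
    have e2 : B l j - B j l + P = 2 * P * (if j < l then 1 else 0) := by
      simp only [B]
      rcases lt_or_gt_of_ne hjl with hlt | hlt
      · simp only [if_pos hlt, if_neg hlt.not_gt]; ring
      · simp only [if_pos hlt, if_neg hlt.not_gt]; ring
    have h6 : (2 * P) *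
        ((n i j k - m i j l + m k l j - n k l i + (if j < l then 1 else 0) : ℤ) : ℂ) = 0 := by
      push_cast
      rw [mul_add, ← e2]
      linear_combination h5 - e1
    exact_mod_cast (mul_eq_zero.1 h6).resolve_left hP0
  -- Parity of the eighteen equations: each integer `n i j k` or `m i j l` that occurs does so in
  -- exactly two of them, with coefficient `±1`, while the constants add up to `9`. The sum is
  -- therefore odd, yet zero.
  have k1 : ∀ i k, i < k → _ := fun i k hik => And.intro (key i k 0 1 hik (by decide))
    (And.intro (key i k 0 2 hik (by decide)) (And.intro (key i k 1 0 hik (by decide))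
      (And.intro (key i k 1 2 hik (by decide)) (And.intro (key i k 2 0 hik (by decide))
        (key i k 2 1 hik (by decide))))))
  have k2 := k1 0 1 (by decide)
  have k3 := k1 0 2 (by decide)
  have k4 := k1 1 2 (by decide)
  simp at k2 k3 k4
  omega

theorem not_exists_weak_drawing_K33 (a b : Fin 3 → Plane) (S : Fin 3 → Fin 3 → Set Plane)
    (hS : ∀ i j, JoinedIn (S i j) (a i) (b j))
    (h : ∀ i k j l, i ≠ k → j ≠ l → Disjoint (S i j) (S k l)) : False := by
  choose γ hγ using hS
  refine not_exists_weak_drawing_K33_complex (fun i => planeHomeomorph (a i))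
    (fun j => planeHomeomorph (b j)) (fun i j => (γ i j).map planeHomeomorph.continuous) ?_
  intro i k j l hik hjl
  rw [Set.disjoint_left]
  rintro _ ⟨s, rfl⟩ ⟨t, ht⟩
  have hst := planeHomeomorph.injective ht
  exact Set.disjoint_left.1 (h i k j l hik hjl) (hγ i j s) (hst ▸ hγ k l t)

/-! ### Simple arcs and boundaries of faces -/

/-- `x` and `y` are the ends of a simple arc contained in `S`. -/
def ArcJoinedIn {E : Type*} [TopologicalSpace E] (S : Set E) (x y : E) : Prop :=
  ∃ γ : Path x y, Function.Injective γ ∧ range γ ⊆ S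

theorem Path.injective_subpath {E : Type*} [TopologicalSpace E] {x y : E} {γ : Path x y}
    (hγ : Function.Injective γ) {s t : I} (h : s ≠ t) : Function.Injective (γ.subpath s t) := by
  refine hγ.comp fun u v huv => ?_
  have h1 := congrArg Subtype.val huv
  simp only [Icc.coe_convexComb] at h1
  have h2 : (t - s : ℝ) ≠ 0 := fun h0 => h (Subtype.ext (by linarith))
  exact Subtype.ext (mul_right_cancel₀ h2 (by linear_combination h1))

theorem Path.injective_trans {E : Type*} [TopologicalSpace E] {x y z : E} {γ : Path x y}
    {γ' : Path y z} (hγ : Function.Injective γ) (hγ' : Function.Injective γ')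
    (h : range γ ∩ range γ' ⊆ {y}) : Function.Injective (γ.trans γ') := by
  have key : ∀ s t : I, γ s = γ' t → s = 1 ∧ t = 0 := by
    intro s t hst
    have hy : γ s = y := h ⟨⟨s, rfl⟩, ⟨t, hst.symm⟩⟩
    exact ⟨hγ (hy.trans γ.target.symm), hγ' ((hst.symm.trans hy).trans γ'.source.symm)⟩
  intro s t hst
  rw [Path.trans_apply, Path.trans_apply] at hst
  split_ifs at hst with h1 h2 h2
  · have := congrArg Subtype.val (hγ hst)
    exact Subtype.ext (by simpa using this)
  · obtain ⟨-, h4⟩ := key _ _ hst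
    have := congrArg Subtype.val h4
    simp at this
    exact absurd (by linarith) h2
  · obtain ⟨-, h4⟩ := key _ _ hst.symm
    have := congrArg Subtype.val h4
    simp at this
    exact absurd (by linarith) h1
  · have := congrArg Subtype.val (hγ' hst)
    exact Subtype.ext (by simpa using this)

namespace ArcJoinedIn

section

variable {E : Type*} [TopologicalSpace E] {S T : Set E} {x y z : E}

theorem mono (h : ArcJoinedIn S x y) (hST : S ⊆ T) : ArcJoinedIn T x y := by
  obtain ⟨γ, hγ, hγ'⟩ := h
  exact ⟨γ, hγ, hγ'.trans hST⟩

theorem symm (h : ArcJoinedIn S x y) : ArcJoinedIn S y x := by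
  obtain ⟨γ, hγ, hγ'⟩ := h
  refine ⟨γ.symm, fun s t hst => ?_, by rwa [Path.symm_range]⟩
  exact symm_bijective.1 (hγ hst)

theorem of_subpath {γ : Path x y} (hγ : Function.Injective γ) {s t : I} (h : s ≠ t) :
    ArcJoinedIn (γ '' uIcc s t) (γ s) (γ t) :=
  ⟨γ.subpath s t, Path.injective_subpath hγ h, (γ.range_subpath s t).le⟩

/-- Plain concatenation may lose injectivity. Instead `γ` is followed up to its first point on `δ`,
and `δ` from there on; when that point is `x` or `z`, a single subarc suffices. -/
theorem trans [T2Space E] (h1 : ArcJoinedIn S x y) (h2 : ArcJoinedIn S y z) (hxz : x ≠ z) :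
    ArcJoinedIn S x z := by
  obtain ⟨γ, hγ, hγS⟩ := h1
  obtain ⟨δ, hδ, hδS⟩ := h2
  have hcl : IsClosed (γ ⁻¹' range δ) :=
    (isCompact_range δ.continuous).isClosed.preimage γ.continuous
  obtain ⟨s, ⟨u, hu⟩, hs⟩ := hcl.isCompact.exists_isLeast
    ⟨1, 0, by rw [γ.target, δ.source]⟩
  have hmin : ∀ t, γ t ∈ range δ → s ≤ t := fun t ht => hs ht
  rcases eq_or_ne s 0 with rfl | hs0
  · rw [γ.source] at hu
    have hu1 : u ≠ 1 := by
      rintro rfl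
      exact hxz (hu.symm.trans δ.target)
    have := of_subpath hδ hu1
    rw [hu, δ.target] at this
    exact this.mono ((image_subset_range _ _).trans hδS)
  · rcases eq_or_ne u 1 with rfl | hu1
    · have := of_subpath hγ hs0.symm
      rw [γ.source, ← hu, δ.target] at this
      exact this.mono ((image_subset_range _ _).trans hγS)
    · let α : Path x (γ s) := (γ.subpath 0 s).cast γ.source.symm rfl
      let β : Path (γ s) z := (δ.subpath u 1).cast hu.symm δ.target.symm
      have hα : range α = γ '' Icc 0 s := γ.range_subpath_of_le 0 s nonneg'
      have hβ : range β = δ '' Icc u 1 := δ.range_subpath_of_le u 1 le_one'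
      refine ⟨α.trans β, Path.injective_trans (Path.injective_subpath hγ hs0.symm)
        (Path.injective_subpath hδ hu1) ?_, ?_⟩
      · rw [hα, hβ]
        rintro _ ⟨⟨t, ht, rfl⟩, ⟨v, hv, hv'⟩⟩
        rw [mem_singleton_iff, le_antisymm ht.2 (hmin t ⟨v, hv'⟩)]
      · rw [Path.trans_range, hα, hβ]
        exact union_subset ((image_subset_range _ _).trans hγS)
          ((image_subset_range _ _).trans hδS)

end

section

variable {E : Type*} [NormedAddCommGroup E] [NormedSpace ℝ E] {S U : Set E} {x y : E}

theorem of_segment (hxy : x ≠ y) (h : segment ℝ x y ⊆ S) : ArcJoinedIn S x y := by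
  refine ⟨⟨⟨fun t : I => AffineMap.lineMap x y (t : ℝ), by fun_prop⟩, by simp, by simp⟩, ?_, ?_⟩
  · intro s t hst
    exact Subtype.ext (AffineMap.lineMap_injective ℝ hxy hst)
  · rintro _ ⟨t, rfl⟩
    refine h ?_
    rw [segment_eq_image_lineMap]
    exact ⟨t, t.2, rfl⟩

/-- Being equal or joined by an arc is an equivalence relation, and segments in balls show that it
holds locally. -/
theorem of_isOpen (hU : IsOpen U) (hc : IsPreconnected U) (hx : x ∈ U) (hy : y ∈ U)
    (hxy : x ≠ y) : ArcJoinedIn U x y := by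
  refine (hc.induction₂ (fun x y => x = y ∨ ArcJoinedIn U x y) ?_ ?_ ?_ hx hy).resolve_left hxy
  · intro x hx
    obtain ⟨ε, hε, hball⟩ := Metric.isOpen_iff.1 hU x hx
    filter_upwards [mem_nhdsWithin_of_mem_nhds (Metric.ball_mem_nhds x hε)] with y hy
    by_cases h : x = y
    · exact Or.inl h
    · exact Or.inr (of_segment h
        (((convex_ball x ε).segment_subset (mem_ball_self hε) hy).trans hball))
  · rintro x y z - - - (rfl | h1) (rfl | h2)
    · exact Or.inl rfl
    · exact Or.inr h2
    · exact Or.inr h1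
    · by_cases hxz : x = z
      · exact Or.inl hxz
      · exact Or.inr (h1.trans h2 hxz)
  · rintro x y - - (rfl | h)
    · exact Or.inl rfl
    · exact Or.inr h.symm

end

end ArcJoinedIn

/-- A path from a closed set `A` to a disjoint closed set `B` contains a subpath which meets `A`
and `B` exactly in its two ends. -/
theorem exists_trimmed_times {E : Type*} [TopologicalSpace E] {x y : E} (γ : Path x y)
    {A B : Set E} (hA : IsClosed A) (hB : IsClosed B) (hAB : Disjoint A B) (hx : x ∈ A)
    (hy : y ∈ B) :
    ∃ s t : I, s < t ∧ γ s ∈ A ∧ γ t ∈ B ∧ (∀ u ∈ Icc s t, γ u ∈ A → u = s) ∧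
      ∀ u ∈ Icc s t, γ u ∈ B → u = t := by
  obtain ⟨t, ht, htmin⟩ := (hB.preimage γ.continuous).isCompact.exists_isLeast
    ⟨1, by rw [mem_preimage, γ.target]; exact hy⟩
  obtain ⟨s, hs, hsmax⟩ := ((hA.preimage γ.continuous).inter isClosed_Iic).isCompact.exists_isGreatest
    (⟨0, by rw [mem_preimage, γ.source]; exact hx, nonneg'⟩ : (γ ⁻¹' A ∩ Iic t).Nonempty)
  refine ⟨s, t, lt_of_le_of_ne hs.2 ?_, hs.1, ht, fun u hu huA => ?_, fun u hu huB => ?_⟩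
  · rintro rfl
    exact Set.disjoint_left.1 hAB hs.1 ht
  · exact le_antisymm (hsmax ⟨huA, hu.2⟩) hu.1
  · exact le_antisymm hu.2 (htmin huB)

/-- A face which has an inner point of an arc in its closure has the ends of the arc in its
closure. -/
theorem target_mem_closure_of_mem_closure {X F : Set Plane} {u v z : Plane} (hX : IsCompact X)
    (γ : Path u v) (hγ : Function.Injective γ) (hXγ : X ∩ range γ ⊆ {u, v}) (hv : v ∈ X)
    (hF : IsOpen F) (hFX : Disjoint F (X ∪ range γ)) (hfr : frontier F ⊆ X ∪ range γ)
    (hz : z ∈ closure F) (hzγ : z ∈ range γ) (hzX : z ∉ X) : v ∈ closure F := by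
  -- Otherwise a final piece `γ '' Icc s 1` misses `closure F`. Neither `X` nor the arc `γ '' Icc 0
  -- s` separates a point `p` of `F` near `z` from a later point `γ s'`, and the two sets share at
  -- most `u`; by Janiszewski their union does not separate either.
  by_contra hvF
  obtain ⟨t, rfl⟩ := hzγ
  have ht1 : t < 1 := by
    refine lt_of_le_of_ne le_one' ?_
    rintro rfl
    exact hzX (by rwa [γ.target])
  obtain ⟨s, hts, hs1, hs⟩ : ∃ s, t < s ∧ s < 1 ∧ ∀ w ∈ Icc s 1, γ w ∉ closure F := by
    have h1 : γ ⁻¹' (closure F)ᶜ ∈ 𝓝 (1 : I) := by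
      refine (isClosed_closure.isOpen_compl.preimage γ.continuous).mem_nhds ?_
      rw [mem_preimage, γ.target]; exact hvF
    obtain ⟨l, hl, hl'⟩ := exists_Ioc_subset_of_mem_nhds h1 ⟨t, ht1⟩
    obtain ⟨r, hr, hr1⟩ := exists_between (max_lt ht1 hl)
    exact ⟨r, (le_max_left _ _).trans_lt hr, hr1, fun w hw =>
      hl' ⟨((le_max_right _ _).trans_lt hr).trans_le hw.1, hw.2⟩⟩
  obtain ⟨s', hss', hs'1⟩ := exists_between hs1
  have hin : ∀ w, w ≠ 0 → w ≠ 1 → γ w ∉ X := by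
    intro w h0 h1 hw
    rcases hXγ ⟨hw, w, rfl⟩ with h | h
    · exact h0 (hγ (h.trans γ.source.symm))
    · exact h1 (hγ (h.trans γ.target.symm))
  have hinT : ∀ w ∈ Icc t s', γ w ∉ X := by
    intro w hw
    rcases eq_or_ne w t with rfl | hwt
    · exact hzX
    · exact hin w (ne_bot_of_gt (lt_of_le_of_ne hw.1 hwt.symm)) (hw.2.trans_lt hs'1).ne
  obtain ⟨ε, hε, hball⟩ := Metric.isOpen_iff.1 hX.isClosed.isOpen_compl _ hzX
  obtain ⟨p, hpF, hp⟩ := Metric.mem_closure_iff.1 hz ε hε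
  have hpX : JoinedIn Xᶜ p (γ s') := by
    have h1 : JoinedIn Xᶜ p (γ t) := by
      refine JoinedIn.mono (JoinedIn.of_segment_subset
        ((convex_ball (γ t) ε).segment_subset ?_ (mem_ball_self hε))) hball
      rwa [mem_ball, dist_comm]
    refine h1.trans ⟨γ.subpath t s', fun w => ?_⟩
    have hw : γ.subpath t s' w ∈ γ '' Icc t s' := by
      rw [← γ.range_subpath_of_le t s' (hts.le.trans hss'.le)]; exact mem_range_self w
    obtain ⟨w', hw', he⟩ := hw
    rw [← he]
    exact hinT w' hw'
  have hs0 : (0 : I) < s := nonneg'.trans_lt hts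
  have hr : range (γ.subpath 0 s) = γ '' Icc 0 s := γ.range_subpath_of_le 0 s nonneg'
  have hpγ : JoinedIn (γ '' Icc 0 s)ᶜ p (γ s') := by
    rw [← hr]
    refine joinedIn_compl_range _ (Path.injective_subpath hγ hs0.ne) ?_ ?_
    · rw [hr]
      rintro ⟨w, -, hw⟩
      exact Set.disjoint_left.1 hFX hpF (Or.inr ⟨w, hw⟩)
    · rw [hr]
      rintro ⟨w, hw, hw'⟩
      exact (hw.2.trans_lt hss').ne (hγ hw')
  have hY : JoinedIn (X ∪ γ '' Icc 0 s)ᶜ p (γ s') := by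
    refine joinedIn_compl_union (c := u) hX (isCompact_Icc.image γ.continuous) ?_ hpX hpγ
    rintro _ ⟨hw, w, hws, rfl⟩
    rcases hXγ ⟨hw, w, rfl⟩ with h | h
    · exact h
    · exact absurd (hγ (h.trans γ.target.symm)) (hws.2.trans_lt hs1).ne
  obtain ⟨δ, hδ⟩ := hY
  -- The path `δ` could leave `F` only through `X` or `γ`, thus only through the final piece, which
  -- misses `closure F`. So `γ s'` lies in `F`, which is absurd.
  refine Set.disjoint_left.1 hFX ((isPreconnected_range δ.continuous).subset_of_closure_inter_subset
    hF ⟨p, ⟨0, δ.source⟩, hpF⟩ ?_ ⟨1, δ.target⟩) (Or.inr ⟨s', rfl⟩)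
  rintro _ ⟨hwF, w, rfl⟩
  by_contra hw
  rcases hfr ⟨hwF, by rwa [hF.interior_eq]⟩ with h | ⟨w', hw'⟩
  · exact hδ w (Or.inl h)
  · rcases le_total w' s with h | h
    · exact hδ w (Or.inr ⟨w', ⟨nonneg', h⟩, hw'⟩)
    · exact hs w' ⟨h, le_one'⟩ (hw' ▸ hwF)

/-- The subarc runs from the last visit to the first disc to the first visit to the second. Its ends
lie on the spheres, since from an interior point the path would stay in the disc for a while longer.
-/
theorem exists_trimmed_arc {E : Type*} [NormedAddCommGroup E] {x y c d : E} {r r' : ℝ}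
    (γ : Path x y) (hγ : Function.Injective γ)
    (hdisj : Disjoint (closedBall c r) (closedBall d r')) (hx : x ∈ closedBall c r)
    (hy : y ∈ closedBall d r') :
    ∃ M ⊆ range γ, ∃ p ∈ sphere c r, ∃ q ∈ sphere d r', IsCompact M ∧ p ∈ M ∧ q ∈ M ∧
      M ∩ closedBall c r ⊆ {p} ∧ M ∩ closedBall d r' ⊆ {q} ∧ ArcJoinedIn M p q := by
  obtain ⟨s, t, hst, hs, ht, hs', ht'⟩ :=
    exists_trimmed_times γ isClosed_closedBall isClosed_closedBall hdisj hx hy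
  refine ⟨γ '' Icc s t, image_subset_range _ _, γ s, ?_, γ t, ?_, isCompact_Icc.image γ.continuous,
    mem_image_of_mem _ (left_mem_Icc.2 hst.le), mem_image_of_mem _ (right_mem_Icc.2 hst.le), ?_, ?_,
    (ArcJoinedIn.of_subpath hγ hst.ne).mono (by rw [uIcc_of_le hst.le])⟩
  · refine mem_sphere.2 (le_antisymm hs (not_lt.1 fun hlt => ?_))
    have h1 : ∀ᶠ u in 𝓝[>] s, γ u ∈ ball c r :=
      mem_nhdsWithin_of_mem_nhds ((isOpen_ball.preimage γ.continuous).mem_nhds hlt)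
    have := nhdsGT_neBot_of_exists_gt ⟨t, hst⟩
    obtain ⟨u, hu, hu'⟩ := (h1.and (Ioo_mem_nhdsGT hst)).exists
    exact hu'.1.ne' (hs' u (Ioo_subset_Icc_self hu') (ball_subset_closedBall hu))
  · refine mem_sphere.2 (le_antisymm ht (not_lt.1 fun hlt => ?_))
    have h1 : ∀ᶠ u in 𝓝[<] t, γ u ∈ ball d r' :=
      mem_nhdsWithin_of_mem_nhds ((isOpen_ball.preimage γ.continuous).mem_nhds hlt)
    have := nhdsLT_neBot_of_exists_lt ⟨s, hst⟩
    obtain ⟨u, hu, hu'⟩ := (h1.and (Ioo_mem_nhdsLT hst)).exists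
    exact hu'.2.ne (ht' u (Ioo_subset_Icc_self hu') (ball_subset_closedBall hu))
  · rintro _ ⟨⟨u, hu, rfl⟩, huc⟩
    rw [hs' u hu huc]; rfl
  · rintro _ ⟨⟨u, hu, rfl⟩, hud⟩
    rw [ht' u hu hud]; rfl

/-! ### Radial segments and the insertion of an edge into a face -/

theorem exists_smul_eq_of_mem_segment_sphere {E : Type*} [NormedAddCommGroup E]
    [NormedSpace ℝ E] {c p x : E} {r : ℝ} (hp : p ∈ sphere c r) (hx : x ∈ segment ℝ c p) :
    ∃ t : ℝ, 0 ≤ t ∧ x - c = t • (p - c) ∧ ‖x - c‖ = t * r := by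
  rw [segment_eq_image'] at hx
  obtain ⟨t, ht, rfl⟩ := hx
  refine ⟨t, ht.1, by simp, ?_⟩
  rw [add_sub_cancel_left, norm_smul, Real.norm_of_nonneg ht.1, mem_sphere_iff_norm.1 hp]

theorem segment_inter_sphere_subset {E : Type*} [NormedAddCommGroup E]
    [NormedSpace ℝ E] {c p : E} {r : ℝ} (hr : 0 < r) (hp : p ∈ sphere c r) :
    segment ℝ c p ∩ sphere c r ⊆ {p} := by
  rintro x ⟨hx, hxr⟩
  obtain ⟨t, -, h1, h2⟩ := exists_smul_eq_of_mem_segment_sphere hp hx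
  rw [mem_sphere_iff_norm.1 hxr] at h2
  have : t = 1 := by
    have := mul_right_cancel₀ hr.ne' (h2.symm.trans (one_mul r).symm)
    exact this
  rw [this, one_smul] at h1
  exact sub_left_injective h1

theorem segment_inter_segment_subset {E : Type*} [NormedAddCommGroup E]
    [NormedSpace ℝ E] {c p q : E} {r : ℝ} (hr : 0 < r) (hp : p ∈ sphere c r) (hq : q ∈ sphere c r)
    (hpq : p ≠ q) : segment ℝ c p ∩ segment ℝ c q ⊆ {c} := by
  rintro x ⟨hx, hx'⟩
  obtain ⟨t, -, h1, h2⟩ := exists_smul_eq_of_mem_segment_sphere hp hx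
  obtain ⟨s, -, h3, h4⟩ := exists_smul_eq_of_mem_segment_sphere hq hx'
  have hts : t = s := mul_right_cancel₀ hr.ne' (h2.symm.trans h4)
  subst hts
  have h5 : t • (p - q) = 0 := by
    rw [← sub_sub_sub_cancel_right p q c, smul_sub, ← h1, ← h3, sub_self]
  rcases smul_eq_zero.1 h5 with h | h
  · rw [h, zero_smul] at h1
    exact sub_eq_zero.1 h1
  · exact absurd (sub_eq_zero.1 h) hpq

theorem segment_subset_closedBall {E : Type*} [NormedAddCommGroup E]
    [NormedSpace ℝ E] {c p : E} {r : ℝ} (hp : p ∈ sphere c r) :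
    segment ℝ c p ⊆ closedBall c r := by
  refine (convex_closedBall c r).segment_subset (mem_closedBall_self ?_)
    (sphere_subset_closedBall hp)
  rw [← mem_sphere.1 hp]; exact dist_nonneg

/-- A graph is planar if there are disjoint arcs which connect small discs about its vertices:
these are prolonged to the vertices by radial segments. -/
theorem isPlanar_of_trimmed_arcs {V : Type*} {H : SimpleGraph V} {pt : V → Plane} {ρ : V → ℝ}
    (hρ : ∀ v, 0 < ρ v)
    (hball : ∀ v w, v ≠ w → Disjoint (closedBall (pt v) (ρ v)) (closedBall (pt w) (ρ w)))
    {M : Sym2 V → Set Plane} {p : Sym2 V → V → Plane}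
    (hM : ∀ e ∈ H.edgeSet, ∀ f ∈ H.edgeSet, e ≠ f → Disjoint (M e) (M f))
    (hps : ∀ e ∈ H.edgeSet, ∀ v ∈ e, p e v ∈ sphere (pt v) (ρ v))
    (hpM : ∀ e ∈ H.edgeSet, ∀ v ∈ e, p e v ∈ M e)
    (hMp : ∀ e ∈ H.edgeSet, ∀ v ∈ e, M e ∩ closedBall (pt v) (ρ v) ⊆ {p e v})
    (hout : ∀ e ∈ H.edgeSet, ∀ v ∉ e, Disjoint (M e) (closedBall (pt v) (ρ v)))
    (hjoin : ∀ u v, H.Adj u v → ArcJoinedIn (M s(u, v)) (p s(u, v) u) (p s(u, v) v)) :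
    IsPlanar H := by
  classical
  have hinj : Function.Injective pt := by
    intro v w hvw
    by_contra hne
    refine Set.disjoint_left.1 (hball v w hne) (mem_closedBall_self (hρ v).le) ?_
    rw [hvw]; exact mem_closedBall_self (hρ w).le
  have hseg : ∀ e ∈ H.edgeSet, ∀ v ∈ e, segment ℝ (pt v) (p e v) ⊆ closedBall (pt v) (ρ v) :=
    fun e he v hv => segment_subset_closedBall (hps e he v hv)
  have hne : ∀ e ∈ H.edgeSet, ∀ v ∈ e, pt v ≠ p e v := by
    intro e he v hv h
    have := hps e he v hv
    rw [← h, mem_sphere, dist_self] at this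
    exact (hρ v).ne this
  have hnM : ∀ e ∈ H.edgeSet, ∀ v, pt v ∉ M e := by
    intro e he v hvM
    by_cases hv : v ∈ e
    · exact hne e he v hv (hMp e he v hv ⟨hvM, mem_closedBall_self (hρ v).le⟩)
    · exact Set.disjoint_left.1 (hout e he v hv) hvM (mem_closedBall_self (hρ v).le)
  let N : Sym2 V → Set Plane := fun e => M e ∪ ⋃ v ∈ e, segment ℝ (pt v) (p e v)
  have hsegN : ∀ e, ∀ v ∈ e, segment ℝ (pt v) (p e v) ⊆ N e := fun e v hv =>
    subset_union_of_subset_right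
      (subset_biUnion_of_mem (u := fun v => segment ℝ (pt v) (p e v)) hv) _
  have hN : ∀ u v, H.Adj u v → ArcJoinedIn (N s(u, v)) (pt u) (pt v) := by
    intro u v huv
    have he : s(u, v) ∈ H.edgeSet := huv
    have hu := Sym2.mem_mk_left u v
    have hv := Sym2.mem_mk_right u v
    have h1 : ArcJoinedIn (N s(u, v)) (pt u) (p s(u, v) u) :=
      .of_segment (hne _ he u hu) (hsegN _ u hu)
    have h2 : ArcJoinedIn (N s(u, v)) (p s(u, v) v) (pt v) :=
      (ArcJoinedIn.of_segment (hne _ he v hv) (hsegN _ v hv)).symm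
    have h3 : ArcJoinedIn (N s(u, v)) (p s(u, v) u) (p s(u, v) v) :=
      (hjoin u v huv).mono subset_union_left
    refine h1.trans (h3.trans h2 fun h => ?_) (hinj.ne huv.ne)
    exact hnM _ he v (h ▸ hpM _ he u hu)
  -- One set per unordered pair: the arc is chosen for one orientation and reversed for the other;
  -- non-edges get `∅`.
  have harc : ∀ e : Sym2 V, ∃ A : Set Plane, e ∈ H.edgeSet → A ⊆ N e ∧
      ∀ u v, e = s(u, v) → ∃ γ : Path (pt u) (pt v), Function.Injective γ ∧ range γ = A := by
    intro e
    induction e with | _ u v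
    by_cases huv : H.Adj u v
    · obtain ⟨γ, hγ, hγN⟩ := hN u v huv
      refine ⟨range γ, fun _ => ⟨hγN, fun u' v' h => ?_⟩⟩
      rcases Sym2.eq_iff.1 h with ⟨rfl, rfl⟩ | ⟨rfl, rfl⟩
      · exact ⟨γ, hγ, rfl⟩
      · exact ⟨γ.symm, hγ.comp symm_bijective.1, γ.symm_range⟩
    · exact ⟨∅, fun h => absurd h huv⟩
  choose A hA using harc
  refine ⟨⟨pt, A, hinj, fun u v huv => (hA _ huv).2 u v rfl, ?_, ?_⟩⟩
  · intro e he v hvA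
    rcases (hA e he).1 hvA with h | h
    · exact absurd h (hnM e he v)
    · obtain ⟨w, hw, hvw⟩ := mem_iUnion₂.1 h
      by_contra hv
      refine Set.disjoint_left.1 (hball v w ?_) (mem_closedBall_self (hρ v).le)
        (hseg e he w hw hvw)
      rintro rfl; exact hv hw
  · rintro e he f hf hef x ⟨hxe, hxf⟩
    have key : ∀ e ∈ H.edgeSet, ∀ f ∈ H.edgeSet, e ≠ f → x ∈ M e →
        ∀ v ∈ f, x ∉ segment ℝ (pt v) (p f v) := by
      intro e he f hf hef hx v hv hxs
      have hxb := hseg f hf v hv hxs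
      by_cases hve : v ∈ e
      · have hxp : x = p e v := hMp e he v hve ⟨hx, hxb⟩
        have hxq : x = p f v := segment_inter_sphere_subset (hρ v) (hps f hf v hv)
          ⟨hxs, hxp ▸ hps e he v hve⟩
        exact Set.disjoint_left.1 (hM e he f hf hef) hx (hxq ▸ hpM f hf v hv)
      · exact Set.disjoint_left.1 (hout e he v hve) hx hxb
    rcases (hA e he).1 hxe with h1 | h1 <;> rcases (hA f hf).1 hxf with h2 | h2
    · exact absurd h2 (Set.disjoint_left.1 (hM e he f hf hef) h1)
    · obtain ⟨v, hv, h2⟩ := mem_iUnion₂.1 h2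
      exact absurd h2 (key e he f hf hef h1 v hv)
    · obtain ⟨v, hv, h1⟩ := mem_iUnion₂.1 h1
      exact absurd h1 (key f hf e he hef.symm h2 v hv)
    · obtain ⟨v, hv, h1⟩ := mem_iUnion₂.1 h1
      obtain ⟨w, hw, h2⟩ := mem_iUnion₂.1 h2
      obtain rfl : v = w := by
        by_contra hvw
        exact Set.disjoint_left.1 (hball v w hvw) (hseg e he v hv h1) (hseg f hf w hw h2)
      refine ⟨v, hv, hw, segment_inter_segment_subset (hρ v) (hps e he v hv) (hps f hf v hw) ?_
        ⟨h1, h2⟩⟩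
      intro h
      exact Set.disjoint_left.1 (hM e he f hf hef) (hpM e he v hv) (h ▸ hpM f hf v hw)

theorem eventually_disjoint_closedBall {E : Type*} [PseudoMetricSpace E] {C : Set E}
    (hC : IsClosed C) {x : E} (hx : x ∉ C) : ∀ᶠ r in 𝓝[>] (0 : ℝ), Disjoint C (closedBall x r) := by
  obtain ⟨ε, hε, h⟩ := Metric.isOpen_iff.1 hC.isOpen_compl x hx
  filter_upwards [Ioo_mem_nhdsGT hε] with r hr
  exact Set.disjoint_left.2 fun z hz hzr => h (closedBall_subset_ball hr.2 hzr) hz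

theorem eventually_disjoint_closedBall_closedBall {E : Type*} [MetricSpace E] {x y : E}
    (h : x ≠ y) : ∀ᶠ r in 𝓝[>] (0 : ℝ), Disjoint (closedBall x r) (closedBall y r) := by
  have : 0 < dist x y / 2 := half_pos (dist_pos.2 h)
  filter_upwards [Ioo_mem_nhdsGT this] with r hr
  exact closedBall_disjoint_closedBall (by linarith [hr.2])

namespace PlaneDrawing

variable {V : Type*} {G : SimpleGraph V} (D : PlaneDrawing G)

/-- The points of the plane which are covered by the vertices in `W` and the edges in `E`. -/
def carrier (W : Set V) (E : Set (Sym2 V)) : Set Plane := D.point '' W ∪ ⋃ e ∈ E, D.arc e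

variable {D}

theorem point_mem_carrier {W : Set V} {E : Set (Sym2 V)} {v : V} (hv : v ∈ W) :
    D.point v ∈ D.carrier W E := Or.inl (mem_image_of_mem _ hv)

theorem arc_subset_carrier {W : Set V} {E : Set (Sym2 V)} {e : Sym2 V} (he : e ∈ E) :
    D.arc e ⊆ D.carrier W E :=
  subset_union_of_subset_right (subset_biUnion_of_mem (u := D.arc) he) _

theorem isCompact_arc {e : Sym2 V} (he : e ∈ G.edgeSet) : IsCompact (D.arc e) := by
  induction e with | _ u v
  obtain ⟨γ, -, hγ⟩ := D.arc_spec u v he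
  rw [← hγ]
  exact isCompact_range γ.continuous

theorem isCompact_carrier [Finite V] {W : Set V} {E : Set (Sym2 V)} (hE : E ⊆ G.edgeSet) :
    IsCompact (D.carrier W E) :=
  (W.toFinite.image _).isCompact.union
    (E.toFinite.isCompact_biUnion fun _ he => isCompact_arc (hE he))

/-- Two vertices in the closure of one face can be connected by a new edge. -/
theorem isPlanar_sup_edge [Finite V] {F : Set Plane} {a b : V} (hab : a ≠ b)  (hFo : IsOpen F) (hFc : IsPreconnected F)
    (hF : Disjoint F (D.carrier univ G.edgeSet)) (ha : D.point a ∈ closure F)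
    (hb : D.point b ∈ closure F) : IsPlanar (G ⊔ SimpleGraph.edge a b) := by
  classical
  have hballs : ∀ᶠ r in 𝓝[>] (0 : ℝ), ∀ v w, v ≠ w →
      Disjoint (closedBall (D.point v) r) (closedBall (D.point w) r) := by
    simp only [eventually_all]
    exact fun v w hvw => eventually_disjoint_closedBall_closedBall (D.point_injective.ne hvw)
  have harcs : ∀ᶠ r in 𝓝[>] (0 : ℝ), ∀ e, e ∈ G.edgeSet → ∀ v, v ∉ e →
      Disjoint (D.arc e) (closedBall (D.point v) r) := by
    simp only [eventually_all]
    exact fun e he v hv => eventually_disjoint_closedBall (isCompact_arc he).isClosed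
      fun h => hv (D.vertex_on_arc e he v h)
  obtain ⟨r, ⟨hr1, hr2⟩, hr⟩ := ((hballs.and harcs).and self_mem_nhdsWithin).exists
  -- The vertices need not be accessible from `F` by arcs: points of `F` in their discs suffice,
  -- because radial segments complete the new edge.
  obtain ⟨p, hpF, hp⟩ := Metric.mem_closure_iff.1 ha r hr
  obtain ⟨q, hqF, hq⟩ := Metric.mem_closure_iff.1 hb r hr
  have hp' : p ∈ closedBall (D.point a) r := mem_closedBall'.2 hp.le
  have hq' : q ∈ closedBall (D.point b) r := mem_closedBall'.2 hq.le
  have hpq : p ≠ q := by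
    rintro rfl
    exact Set.disjoint_left.1 (hr1 a b hab) hp' hq'
  obtain ⟨δ, hδ, hδF⟩ := ArcJoinedIn.of_isOpen hFo hFc hpF hqF hpq
  obtain ⟨M₀, hM₀δ, p₀, hp₀, q₀, hq₀, hM₀c, hp₀M, hq₀M, hM₀a, hM₀b, hM₀⟩ :=
    exists_trimmed_arc δ hδ (hr1 a b hab) hp' hq'
  have hM₀F : M₀ ⊆ F := hM₀δ.trans hδF
  have hM₀' : ∀ᶠ s in 𝓝[>] (0 : ℝ), ∀ v, Disjoint M₀ (closedBall (D.point v) s) := by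
    simp only [eventually_all]
    exact fun v => eventually_disjoint_closedBall hM₀c.isClosed fun h =>
      Set.disjoint_left.1 hF (hM₀F h) (point_mem_carrier (mem_univ v))
  obtain ⟨s, hs1, hs⟩ := (hM₀'.and (Ioo_mem_nhdsGT hr)).exists
  -- The new arc ends on the discs of radius `r` about `a` and `b`, but may cross those about other
  -- vertices; these are shrunk to radius `s`.
  let ρ : V → ℝ := fun v => if v = a ∨ v = b then r else s
  have hρr : ∀ v, ρ v ≤ r := by
    intro v; simp only [ρ]; split_ifs
    exacts [le_rfl, hs.2.le]
  have hρ : ∀ v, 0 < ρ v := by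
    intro v; simp only [ρ]; split_ifs
    exacts [hr, hs.1]
  have hρa : ρ a = r := if_pos (Or.inl rfl)
  have hρb : ρ b = r := if_pos (Or.inr rfl)
  have hball : ∀ v w, v ≠ w →
      Disjoint (closedBall (D.point v) (ρ v)) (closedBall (D.point w) (ρ w)) := fun v w hvw =>
    (hr1 v w hvw).mono (closedBall_subset_closedBall (hρr v)) (closedBall_subset_closedBall (hρr w))
  have hH : ∀ e, e ∈ (G ⊔ SimpleGraph.edge a b).edgeSet ↔ e ∈ G.edgeSet ∨ e = s(a, b) := by
    intro e
    rw [SimpleGraph.edgeSet_sup, SimpleGraph.edgeSet_edge_of_ne hab]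
    rfl
  have hex : ∀ e : Sym2 V, ∃ (M : Set Plane) (p : V → Plane),
      e ∈ (G ⊔ SimpleGraph.edge a b).edgeSet →
      ((e ∈ G.edgeSet ∧ M ⊆ D.arc e) ∨ (e = s(a, b) ∧ M ⊆ F)) ∧
      (∀ v ∈ e, p v ∈ sphere (D.point v) (ρ v) ∧ p v ∈ M ∧
        M ∩ closedBall (D.point v) (ρ v) ⊆ {p v}) ∧
      (∀ v ∉ e, Disjoint M (closedBall (D.point v) (ρ v))) ∧
      ∀ u v, e = s(u, v) → ArcJoinedIn M (p u) (p v) := by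
    have hcon : ∀ (u v : V) (M : Set Plane) (p q : Plane), u ≠ v →
        p ∈ sphere (D.point u) (ρ u) → q ∈ sphere (D.point v) (ρ v) → p ∈ M → q ∈ M →
        M ∩ closedBall (D.point u) (ρ u) ⊆ {p} → M ∩ closedBall (D.point v) (ρ v) ⊆ {q} →
        ArcJoinedIn M p q → (∀ w ∉ s(u, v), Disjoint M (closedBall (D.point w) (ρ w))) →
        ((s(u, v) ∈ G.edgeSet ∧ M ⊆ D.arc s(u, v)) ∨ (s(u, v) = s(a, b) ∧ M ⊆ F)) →
        ∃ (M : Set Plane) (p : V → Plane),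
          s(u, v) ∈ (G ⊔ SimpleGraph.edge a b).edgeSet →
          ((s(u, v) ∈ G.edgeSet ∧ M ⊆ D.arc s(u, v)) ∨ (s(u, v) = s(a, b) ∧ M ⊆ F)) ∧
          (∀ w ∈ s(u, v), p w ∈ sphere (D.point w) (ρ w) ∧ p w ∈ M ∧
            M ∩ closedBall (D.point w) (ρ w) ⊆ {p w}) ∧
          (∀ w ∉ s(u, v), Disjoint M (closedBall (D.point w) (ρ w))) ∧
          ∀ u' v', s(u, v) = s(u', v') → ArcJoinedIn M (p u') (p v') := by
      intro u v M p q huv hp hq hpM hqM hMp hMq hj hout hor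
      have e1 : (fun w => if w = u then p else q) u = p := if_pos rfl
      have e2 : (fun w => if w = u then p else q) v = q := if_neg huv.symm
      refine ⟨M, fun w => if w = u then p else q, fun _ => ⟨hor, ?_, hout, ?_⟩⟩
      · intro w hw
        rcases Sym2.mem_iff.1 hw with rfl | rfl
        · rw [e1]; exact ⟨hp, hpM, hMp⟩
        · rw [e2]; exact ⟨hq, hqM, hMq⟩
      · intro u' v' h
        rcases Sym2.eq_iff.1 h with ⟨rfl, rfl⟩ | ⟨rfl, rfl⟩
        · rw [e1, e2]; exact hj
        · rw [e1, e2]; exact hj.symm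
    intro e
    by_cases he : e ∈ G.edgeSet
    · induction e with | _ u v
      have huv : u ≠ v := he.ne
      obtain ⟨γ, hγ, hγe⟩ := D.arc_spec u v he
      obtain ⟨M, hMγ, p, hp, q, hq, -, hpM, hqM, hMp, hMq, hj⟩ := exists_trimmed_arc γ hγ
        (hball u v huv) (mem_closedBall_self (hρ u).le) (mem_closedBall_self (hρ v).le)
      refine hcon u v M p q huv hp hq hpM hqM hMp hMq hj (fun w hw => ?_)
        (Or.inl ⟨he, hγe ▸ hMγ⟩)
      exact (hr2 _ he w hw).mono (hγe ▸ hMγ) (closedBall_subset_closedBall (hρr w))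
    · by_cases hea : e = s(a, b)
      · subst hea
        refine hcon a b M₀ p₀ q₀ hab (hρa.symm ▸ hp₀) (hρb.symm ▸ hq₀) hp₀M hq₀M
          (hρa.symm ▸ hM₀a) (hρb.symm ▸ hM₀b) hM₀ (fun w hw => ?_) (Or.inr ⟨rfl, hM₀F⟩)
        have : ρ w = s := if_neg fun h => hw (Sym2.mem_iff.2 h)
        rw [this]; exact hs1 w
      · exact ⟨∅, fun _ => 0, fun h => absurd ((hH e).1 h) (by tauto)⟩
  choose M p hMp using hex
  refine isPlanar_of_trimmed_arcs (M := M) (p := p) hρ hball ?_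
    (fun e he v hv => ((hMp e he).2.1 v hv).1) (fun e he v hv => ((hMp e he).2.1 v hv).2.1)
    (fun e he v hv => ((hMp e he).2.1 v hv).2.2) (fun e he v hv => (hMp e he).2.2.1 v hv)
    (fun u v huv => (hMp s(u, v) huv).2.2.2 u v rfl)
  intro e he f hf hef
  rw [Set.disjoint_left]
  intro x hxe hxf
  have hFarc : ∀ e ∈ G.edgeSet, x ∈ D.arc e → x ∉ F := fun e he hx hxF =>
    Set.disjoint_left.1 hF hxF (arc_subset_carrier he hx)
  rcases (hMp e he).1 with ⟨he', h1⟩ | ⟨he', h1⟩ <;>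
    rcases (hMp f hf).1 with ⟨hf', h2⟩ | ⟨hf', h2⟩
  · obtain ⟨v, hve, hvf, rfl⟩ := D.arc_inter_arc e he' f hf' hef x ⟨h1 hxe, h2 hxf⟩
    obtain ⟨hs, -, hv⟩ := (hMp e he).2.1 v hve
    have := hv ⟨hxe, mem_closedBall_self (hρ v).le⟩
    rw [mem_singleton_iff] at this
    rw [← this, mem_sphere, dist_self] at hs
    exact (hρ v).ne hs
  · exact hFarc e he' (h1 hxe) (h2 hxf)
  · exact hFarc f hf' (h2 hxf) (h1 hxe)
  · exact hef (he'.trans hf'.symm)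

end PlaneDrawing

/-! ### Faces touching both sides of a small clique -/

/-- Let `K` be a closed set with connected complement and let `A`, `B` be closed sets which meet
only in `K`. Then a component of the complement of `A ∪ B ∪ K` has points of both `A` and `B` in
its closure. -/
theorem exists_component_closure_meets {E : Type*} [NormedAddCommGroup E] [NormedSpace ℝ E]
    {A B K : Set E} (hA : IsClosed A) (hB : IsClosed B) (hK : IsClosed K) (hAB : A ∩ B ⊆ K)
    (hKc : IsPreconnected Kᶜ) (hAK : (A \ K).Nonempty) (hBK : (B \ K).Nonempty) :
    ∃ q, (closure (connectedComponentIn (A ∪ B ∪ K)ᶜ q) ∩ (A \ K)).Nonempty ∧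
      (closure (connectedComponentIn (A ∪ B ∪ K)ᶜ q) ∩ (B \ K)).Nonempty := by
  set X := A ∪ B ∪ K with hX
  have hXc : IsClosed X := (hA.union hB).union hK
  by_contra! hcon
  have hopen : ∀ q, IsOpen (connectedComponentIn Xᶜ q) := fun q =>
    hXc.isOpen_compl.connectedComponentIn
  have hfr := frontier_connectedComponentIn_subset hXc
  have hcross : ∀ (q : E) (S : Set E), IsPreconnected S →
      (S ∩ connectedComponentIn Xᶜ q).Nonempty → ¬ S ⊆ connectedComponentIn Xᶜ q →
      ∃ z ∈ S, z ∈ closure (connectedComponentIn Xᶜ q) ∧ z ∈ X := by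
    intro q S hS h1 h2
    by_contra! h3
    refine h2 (hS.subset_of_closure_inter_subset (hopen q) (by rwa [inter_comm] at h1 ⊢) ?_)
    rintro z ⟨hz, hzS⟩
    by_contra hz'
    exact h3 z hzS hz (hfr q ⟨hz, by rwa [(hopen q).interior_eq]⟩)
  -- `U Y` adds to `Y \ K` all components whose closure meets it. If no component touches both
  -- sides, `U A` and `U B` are disjoint on `Kᶜ`; they are open and cover it, contradicting its
  -- connectedness.
  let U : Set E → Set E := fun Y => (Y \ K) ∪
    {q | q ∉ X ∧ (closure (connectedComponentIn Xᶜ q) ∩ (Y \ K)).Nonempty}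
  have hUo : ∀ Y Z, Y ∩ Z ⊆ K → IsClosed Z → X = Y ∪ Z ∪ K → IsOpen (U Y) := by
    intro Y Z hYZ hZ hXY
    rw [Metric.isOpen_iff]
    rintro q (hq | ⟨hqX, hq⟩)
    · have hqZ : q ∈ (Z ∪ K)ᶜ := by
        rintro (h | h)
        exacts [hq.2 (hYZ ⟨hq.1, h⟩), hq.2 h]
      obtain ⟨ε, hε, hball⟩ := Metric.isOpen_iff.1 (hZ.union hK).isOpen_compl q hqZ
      have hXball : ∀ z ∈ ball q ε, z ∈ X → z ∈ Y \ K := by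
        intro z hz hzX
        have := hball hz
        rw [hXY] at hzX
        simp only [mem_compl_iff, mem_union, not_or] at this
        rcases hzX with (h | h) | h
        exacts [⟨h, this.2⟩, absurd h this.1, absurd h this.2]
      refine ⟨ε, hε, fun w hw => ?_⟩
      by_cases hwX : w ∈ X
      · exact Or.inl (hXball w hw hwX)
      · obtain ⟨z, hz, hz1, hz2⟩ := hcross w (ball q ε) (convex_ball q ε).isPreconnected
          ⟨w, hw, mem_connectedComponentIn hwX⟩ (fun h => by
            have := connectedComponentIn_subset _ _ (h (mem_ball_self hε))
            exact this (hXY ▸ Or.inl (Or.inl hq.1)))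
        exact Or.inr ⟨hwX, z, hz1, hXball z hz hz2⟩
    · obtain ⟨ε, hε, hball⟩ := Metric.isOpen_iff.1 (hopen q) q (mem_connectedComponentIn hqX)
      refine ⟨ε, hε, fun w hw => Or.inr ⟨connectedComponentIn_subset _ _ (hball hw), ?_⟩⟩
      rwa [← connectedComponentIn_eq (hball hw)]
  have hsubA : A ⊆ X := fun z hz => Or.inl (Or.inl hz)
  have hsubB : B ⊆ X := fun z hz => Or.inl (Or.inr hz)
  obtain ⟨a, ha⟩ := hAK
  obtain ⟨b, hb⟩ := hBK
  obtain ⟨z, hzK, hzA, hzB⟩ := hKc (U A) (U B) (hUo A B hAB hB rfl)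
    (hUo B A (by rwa [inter_comm]) hA (by rw [hX, union_comm A B])) (by
      intro q hqK
      by_cases hqX : q ∈ X
      · rcases hqX with (h | h) | h
        exacts [Or.inl (Or.inl ⟨h, hqK⟩), Or.inr (Or.inl ⟨h, hqK⟩), absurd h hqK]
      · obtain ⟨z, hzK, hz1, hz2⟩ := hcross q Kᶜ hKc ⟨q, hqK, mem_connectedComponentIn hqX⟩
          (fun h => connectedComponentIn_subset _ _ (h ha.2) (hsubA ha.1))
        rcases hz2 with (h | h) | h
        · exact Or.inl (Or.inr ⟨hqX, z, hz1, h, hzK⟩)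
        · exact Or.inr (Or.inr ⟨hqX, z, hz1, h, hzK⟩)
        · exact absurd h hzK)
    ⟨a, ha.2, Or.inl ha⟩ ⟨b, hb.2, Or.inl hb⟩
  rcases hzA with h1 | ⟨h1, h1'⟩ <;> rcases hzB with h2 | ⟨h2, h2'⟩
  · exact hzK (hAB ⟨h1.1, h2.1⟩)
  · exact h2 (hsubA h1.1)
  · exact h1 (hsubB h2.1)
  · exact h2'.ne_empty (hcon z h1')

namespace PlaneDrawing

variable {V : Type*} {G : SimpleGraph V} {D : PlaneDrawing G}

/-- The rest of the drawing meets the arc of `e` only in its ends, so it can serve as `X` in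
`target_mem_closure_of_mem_closure`. -/
theorem point_mem_closure_of_mem_arc [Finite V] {F : Set Plane} (hF : IsOpen F)
    (hFX : Disjoint F (D.carrier univ G.edgeSet)) (hfr : frontier F ⊆ D.carrier univ G.edgeSet)
    {z : Plane} (hz : z ∈ closure F) {e : Sym2 V} (he : e ∈ G.edgeSet) (hze : z ∈ D.arc e)
    (hzp : z ∉ range D.point) {v : V} (hv : v ∈ e) : D.point v ∈ closure F := by
  obtain ⟨u, rfl⟩ : ∃ u, e = s(u, v) := by
    obtain ⟨u, rfl⟩ := hv
    exact ⟨u, Sym2.eq_swap⟩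
  obtain ⟨γ, hγ, hγe⟩ := D.arc_spec u v he
  have hX : D.carrier univ G.edgeSet =
      D.carrier univ (G.edgeSet \ {s(u, v)}) ∪ range γ := by
    rw [hγe, carrier, carrier, union_assoc, ← biUnion_singleton (s(u, v)) D.arc,
      ← biUnion_union, sdiff_union_of_subset (singleton_subset_iff.2 he)]
  rw [hX] at hFX hfr
  refine target_mem_closure_of_mem_closure (isCompact_carrier sdiff_subset) γ hγ ?_
    (point_mem_carrier (mem_univ v)) hF hFX hfr hz (hγe ▸ hze) ?_
  · rintro x ⟨hx, hxγ⟩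
    rw [hγe] at hxγ
    have hends : ∀ w, w ∈ s(u, v) → D.point w ∈ ({D.point u, D.point v} : Set Plane) := by
      intro w hw
      rcases Sym2.mem_iff.1 hw with rfl | rfl
      exacts [Or.inl rfl, Or.inr rfl]
    rcases hx with ⟨w, -, rfl⟩ | hx
    · exact hends w (D.vertex_on_arc _ he w hxγ)
    · obtain ⟨f, hf, hxf⟩ := mem_iUnion₂.1 hx
      obtain ⟨w, -, hw, rfl⟩ := D.arc_inter_arc f hf.1 _ he hf.2 x ⟨hxf, hxγ⟩
      exact hends w hw
  · rintro (⟨w, -, rfl⟩ | h)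
    · exact hzp ⟨w, rfl⟩
    · obtain ⟨f, hf, hxf⟩ := mem_iUnion₂.1 h
      obtain ⟨w, -, hw, rfl⟩ := D.arc_inter_arc f hf.1 _ he hf.2 z ⟨hxf, hze⟩
      exact hzp ⟨w, rfl⟩

/-- The clique is drawn as the empty set, a point or a single arc, and none of these separates the
plane. -/
theorem isPreconnected_compl_carrier_of_card_le_two {K : Finset V} (hK : G.IsClique K)
    (hc : K.card ≤ 2) :
    IsPreconnected (D.carrier K {e ∈ G.edgeSet | ∀ v ∈ e, v ∈ K})ᶜ := by
  classical
  have hrank : 1 < Module.rank ℝ Plane := by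
    rw [rank_eq_card_basis (EuclideanSpace.basisFun (Fin 2) ℝ).toBasis]; simp
  obtain hc | hc | hc : K.card = 0 ∨ K.card = 1 ∨ K.card = 2 := by omega
  · have : D.carrier K {e ∈ G.edgeSet | ∀ v ∈ e, v ∈ K} = ∅ := by
      rw [Finset.card_eq_zero.1 hc, carrier]
      refine Set.eq_empty_of_forall_notMem ?_
      rintro x (⟨v, hv, -⟩ | hx)
      · simp at hv
      · obtain ⟨e, he, -⟩ := mem_iUnion₂.1 hx
        induction e with | _ u v
        exact absurd (he.2 u (Sym2.mem_mk_left u v)) (by simp)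
    rw [this, compl_empty]; exact isPreconnected_univ
  · obtain ⟨x, rfl⟩ := Finset.card_eq_one.1 hc
    have : D.carrier ({x} : Finset V) {e ∈ G.edgeSet | ∀ v ∈ e, v ∈ ({x} : Finset V)}
        = {D.point x} := by
      refine Subset.antisymm ?_ ?_
      · rintro z (⟨v, hv, rfl⟩ | hz)
        · rw [Finset.mem_singleton.1 (Finset.mem_coe.1 hv)]; rfl
        · obtain ⟨e, he, -⟩ := mem_iUnion₂.1 hz
          induction e with | _ u v
          have h1 := Finset.mem_singleton.1 (he.2 u (Sym2.mem_mk_left u v))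
          have h2 := Finset.mem_singleton.1 (he.2 v (Sym2.mem_mk_right u v))
          exact absurd (h1.trans h2.symm) (SimpleGraph.Adj.ne he.1)
      · rintro _ rfl
        exact point_mem_carrier (by simp)
    rw [this]
    exact (isConnected_compl_singleton_of_one_lt_rank hrank _).isPreconnected
  · obtain ⟨x, y, hxy, rfl⟩ := Finset.card_eq_two.1 hc
    have hadj : G.Adj x y := hK (by simp) (by simp) hxy
    obtain ⟨γ, hγ, hγe⟩ := D.arc_spec x y hadj
    have : D.carrier ({x, y} : Finset V) {e ∈ G.edgeSet | ∀ v ∈ e, v ∈ ({x, y} : Finset V)}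
        = range γ := by
      refine Subset.antisymm ?_ ?_
      · rintro z (⟨v, hv, rfl⟩ | hz)
        · rcases Finset.mem_insert.1 (Finset.mem_coe.1 hv) with rfl | h
          · exact ⟨0, γ.source⟩
          · rw [Finset.mem_singleton.1 h]; exact ⟨1, γ.target⟩
        · obtain ⟨e, he, hze⟩ := mem_iUnion₂.1 hz
          rw [hγe]
          convert hze
          have hx : ∀ v ∈ e, v ∈ s(x, y) := fun v hv => by simpa using he.2 v hv
          induction e with | _ u v
          exact (((Sym2.mem_and_mem_iff (SimpleGraph.Adj.ne he.1)).1
            ⟨hx u (Sym2.mem_mk_left u v), hx v (Sym2.mem_mk_right u v)⟩))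
      · rw [hγe]
        exact arc_subset_carrier ⟨hadj, by simp⟩
    rw [this]
    refine isPreconnected_of_forall_pair fun p hp q hq => ?_
    obtain ⟨δ, hδ⟩ := joinedIn_compl_range γ hγ hp hq
    exact ⟨range δ, by rintro _ ⟨t, rfl⟩; exact hδ t, ⟨0, δ.source⟩, ⟨1, δ.target⟩,
      isPreconnected_range δ.continuous⟩

end PlaneDrawing

section Separation

variable {V : Type*} [Fintype V] [DecidableEq V] {G : SimpleGraph V} {k S S' : Finset V}

theorem isDivision_iff :
    IsDivision G k S S' ↔ Disjoint S S' ∧ S ∪ S' = kᶜ ∧ ∀ u ∈ S, ∀ v ∈ S', ¬ G.Adj u v := by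
  constructor
  · rintro ⟨h1, h2, h3⟩
    refine ⟨h1, h2, fun u hu v hv huv => ?_⟩
    obtain ⟨w, hw, hwk⟩ := h3 u hu v hv huv.toWalk
    have hS : ∀ x ∈ S ∪ S', x ∉ k := fun x hx => Finset.mem_compl.1 (h2 ▸ hx)
    simp only [SimpleGraph.Adj.toWalk, SimpleGraph.Walk.support_cons,
      SimpleGraph.Walk.support_nil, List.mem_cons, List.not_mem_nil, or_false] at hw
    rcases hw with rfl | rfl
    · exact hS _ (Finset.mem_union_left _ hu) hwk
    · exact hS _ (Finset.mem_union_right _ hv) hwk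
  · rintro ⟨h1, h2, h3⟩
    refine ⟨h1, h2, fun u hu v hv p => ?_⟩
    induction p with
    | nil => exact absurd hv (Finset.disjoint_left.1 h1 hu)
    | @cons u w v huw p ih =>
      by_cases hw : w ∈ k
      · exact ⟨w, by simp, hw⟩
      · have : w ∈ S ∪ S' := by rw [h2]; exact Finset.mem_compl.2 hw
        rcases Finset.mem_union.1 this with h | h
        · obtain ⟨x, hx, hxk⟩ := ih h hv
          exact ⟨x, by simp [hx], hxk⟩
        · exact absurd huw (h3 u hu w h)

/-- A maximal planar graph has no separating clique with at most two vertices. -/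
theorem IsMaximalPlanar.not_isSeparating_of_card_le_two (hG : IsMaximalPlanar G)
    {K : Finset V} (hK : G.IsClique K) (hc : K.card ≤ 2) : ¬ IsSeparating G K := by
  rintro ⟨A, B, ⟨a₀, ha₀⟩, ⟨b₀, hb₀⟩, hdiv⟩
  obtain ⟨hAB, hABK, hadj⟩ := isDivision_iff.1 hdiv
  have hmem : ∀ v, v ∈ A ∨ v ∈ B ∨ v ∈ K := by
    intro v
    by_cases hv : v ∈ K
    · exact Or.inr (Or.inr hv)
    · have : v ∈ A ∪ B := by rw [hABK]; exact Finset.mem_compl.2 hv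
      rcases Finset.mem_union.1 this with h | h
      exacts [Or.inl h, Or.inr (Or.inl h)]
  have hAK : ∀ v ∈ A, v ∉ K := fun v hv =>
    Finset.mem_compl.1 (hABK ▸ Finset.mem_union_left B hv)
  have hBK : ∀ v ∈ B, v ∉ K := fun v hv =>
    Finset.mem_compl.1 (hABK ▸ Finset.mem_union_right A hv)
  obtain ⟨D⟩ := hG.prop
  -- Edges between a side and `K` are counted with that side, so every edge belongs to exactly one
  -- of `E A`, `E B` and `EK`.
  let E : Finset V → Set (Sym2 V) := fun W => {e ∈ G.edgeSet | ∃ v ∈ e, v ∈ W}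
  let EK : Set (Sym2 V) := {e ∈ G.edgeSet | ∀ v ∈ e, v ∈ K}
  have hE : ∀ W, E W ⊆ G.edgeSet := fun W e he => he.1
  have hEAB : ∀ e ∈ E A, e ∉ E B := by
    rintro e ⟨he, u, hu, huA⟩ ⟨-, v, hv, hvB⟩
    have huv : u ≠ v := fun h => Finset.disjoint_left.1 hAB huA (h ▸ hvB)
    rw [(Sym2.mem_and_mem_iff huv).1 ⟨hu, hv⟩] at he
    exact hadj u huA v hvB he
  have hX : D.carrier univ G.edgeSet = D.carrier A (E A) ∪ D.carrier B (E B) ∪ D.carrier K EK := by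
    refine Subset.antisymm ?_ ?_
    · rintro z (⟨v, -, rfl⟩ | hz)
      · rcases hmem v with h | h | h
        · exact Or.inl (Or.inl (PlaneDrawing.point_mem_carrier h))
        · exact Or.inl (Or.inr (PlaneDrawing.point_mem_carrier h))
        · exact Or.inr (PlaneDrawing.point_mem_carrier h)
      · obtain ⟨e, he, hze⟩ := mem_iUnion₂.1 hz
        by_cases heA : e ∈ E A
        · exact Or.inl (Or.inl (PlaneDrawing.arc_subset_carrier heA hze))
        by_cases heB : e ∈ E B
        · exact Or.inl (Or.inr (PlaneDrawing.arc_subset_carrier heB hze))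
        · have heK : ∀ v ∈ e, v ∈ K := by
            intro v hv
            rcases hmem v with h | h | h
            exacts [absurd ⟨he, v, hv, h⟩ heA, absurd ⟨he, v, hv, h⟩ heB, h]
          exact Or.inr (PlaneDrawing.arc_subset_carrier (E := EK) ⟨he, heK⟩ hze)
    · have hmono : ∀ (W : Finset V) (E : Set (Sym2 V)), E ⊆ G.edgeSet →
          D.carrier W E ⊆ D.carrier univ G.edgeSet := fun W E h =>
        union_subset_union (image_mono (subset_univ _)) (biUnion_subset_biUnion_left h)
      exact union_subset (union_subset (hmono _ _ (hE A)) (hmono _ _ (hE B)))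
        (hmono _ _ fun e he => he.1)
  have hpt : ∀ (v : V) (W : Finset V), D.point v ∈ D.carrier W (E W) → v ∉ W →
      ∃ e ∈ E W, v ∈ e := by
    rintro v W (⟨w, hw, h⟩ | h) hv
    · exact absurd (D.point_injective h ▸ hw) hv
    · obtain ⟨e, he, h⟩ := mem_iUnion₂.1 h
      exact ⟨e, he, D.vertex_on_arc e he.1 v h⟩
  have hXAB : D.carrier A (E A) ∩ D.carrier B (E B) ⊆ D.carrier K EK := by
    have hvert : ∀ v, D.point v ∈ D.carrier A (E A) → D.point v ∈ D.carrier B (E B) →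
        D.point v ∈ D.carrier K EK := by
      intro v h1 h2
      rcases hmem v with h | h | h
      · obtain ⟨e, he, hve⟩ := hpt v B h2 (Finset.disjoint_left.1 hAB h)
        exact absurd he (hEAB e ⟨he.1, v, hve, h⟩)
      · obtain ⟨e, he, hve⟩ := hpt v A h1 (Finset.disjoint_right.1 hAB h)
        exact (hEAB e he ⟨he.1, v, hve, h⟩).elim
      · exact PlaneDrawing.point_mem_carrier h
    rintro z ⟨h1, h2⟩
    rcases id h1 with ⟨v, -, rfl⟩ | h1'
    · exact hvert v h1 h2
    rcases id h2 with ⟨v, -, rfl⟩ | h2'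
    · exact hvert v h1 h2
    obtain ⟨e, he, hze⟩ := mem_iUnion₂.1 h1'
    obtain ⟨f, hf, hzf⟩ := mem_iUnion₂.1 h2'
    obtain ⟨v, -, -, rfl⟩ := D.arc_inter_arc e he.1 f hf.1 (fun h => hEAB e he (h ▸ hf)) z
      ⟨hze, hzf⟩
    exact hvert v h1 h2
  have hptK : ∀ v, v ∉ K → D.point v ∉ D.carrier K EK := by
    rintro v hv (⟨w, hw, h⟩ | h)
    · exact hv (D.point_injective h ▸ hw)
    · obtain ⟨e, he, h⟩ := mem_iUnion₂.1 h
      exact hv (he.2 v (D.vertex_on_arc e he.1 v h))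
  have hclosed : ∀ (W : Finset V) (E : Set (Sym2 V)), E ⊆ G.edgeSet →
      IsClosed (D.carrier W E) := fun W E h => (PlaneDrawing.isCompact_carrier h).isClosed
  obtain ⟨q, ⟨z, hz, hzA⟩, ⟨w, hw, hwB⟩⟩ := exists_component_closure_meets (hclosed A _ (hE A))
    (hclosed B _ (hE B)) (hclosed K EK fun e he => he.1) hXAB
    (PlaneDrawing.isPreconnected_compl_carrier_of_card_le_two hK hc)
    ⟨_, PlaneDrawing.point_mem_carrier ha₀, hptK a₀ (hAK a₀ ha₀)⟩
    ⟨_, PlaneDrawing.point_mem_carrier hb₀, hptK b₀ (hBK b₀ hb₀)⟩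
  rw [← hX] at hz hw
  have hXc : IsClosed (D.carrier univ G.edgeSet) :=
    (PlaneDrawing.isCompact_carrier Subset.rfl).isClosed
  set F := connectedComponentIn (D.carrier univ G.edgeSet)ᶜ q
  have hFo : IsOpen F := hXc.isOpen_compl.connectedComponentIn
  have hFX : Disjoint F (D.carrier univ G.edgeSet) :=
    disjoint_left.2 fun z hz => connectedComponentIn_subset _ _ hz
  have hfr : frontier F ⊆ D.carrier univ G.edgeSet := frontier_connectedComponentIn_subset hXc q
  -- The face may touch a side only in an inner point of an edge; then the ends of that edge are in
  -- the closure too, and one of them belongs to the side.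
  have hvertex : ∀ W W' : Finset V, (∀ v, v ∈ W ∨ v ∈ W' ∨ v ∈ K) →
      (∀ e ∈ E W, e ∉ E W') → ∀ z ∈ closure F, z ∈ D.carrier W (E W) \ D.carrier K EK →
      ∃ v ∈ W, D.point v ∈ closure F := by
    rintro W W' hWW' hEW z hz ⟨hzW, hzK⟩
    by_cases hzp : z ∈ range D.point
    · obtain ⟨v, rfl⟩ := hzp
      by_cases hv : v ∈ W
      · exact ⟨v, hv, hz⟩
      · obtain ⟨e, he, hve⟩ := hpt v W hzW hv
        rcases hWW' v with h | h | h
        · exact absurd h hv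
        · exact (hEW e he ⟨he.1, v, hve, h⟩).elim
        · exact absurd (PlaneDrawing.point_mem_carrier h) hzK
    · rcases hzW with ⟨v, -, rfl⟩ | hzW
      · exact absurd ⟨v, rfl⟩ hzp
      · obtain ⟨e, ⟨he, v, hve, hv⟩, hze⟩ := mem_iUnion₂.1 hzW
        exact ⟨v, hv, PlaneDrawing.point_mem_closure_of_mem_arc hFo hFX hfr hz he hze hzp hve⟩
  obtain ⟨a, ha, haF⟩ := hvertex A B hmem hEAB z hz hzA
  obtain ⟨b, hb, hbF⟩ := hvertex B A (fun v => by have := hmem v; tauto)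
    (fun e he he' => hEAB e he' he) w hw hwB
  have hab : a ≠ b := fun h => Finset.disjoint_left.1 hAB ha (h ▸ hb)
  have hplanar : IsPlanar (G ⊔ SimpleGraph.edge a b) :=
    PlaneDrawing.isPlanar_sup_edge hab hFo isPreconnected_connectedComponentIn hFX haF hbF
  have hle := hG.le_of_ge hplanar le_sup_left
  exact hadj a ha b hb (hle (Or.inr (by simp [SimpleGraph.edge_adj, hab])))

end Separation

/-! ### Three parts cut off by a triangle -/

namespace PlaneDrawing

variable {V : Type*} {G : SimpleGraph V} {D : PlaneDrawing G}

theorem disjoint_carrier {W W' : Set V} (h : Disjoint W W') :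
    Disjoint (D.carrier W {e ∈ G.edgeSet | ∀ v ∈ e, v ∈ W})
      (D.carrier W' {e ∈ G.edgeSet | ∀ v ∈ e, v ∈ W'}) := by
  have hvert : ∀ (W : Set V) v, D.point v ∈ D.carrier W {e ∈ G.edgeSet | ∀ v ∈ e, v ∈ W} →
      v ∈ W := by
    rintro W v (⟨w, hw, h⟩ | h)
    · exact D.point_injective h ▸ hw
    · obtain ⟨e, he, h⟩ := mem_iUnion₂.1 h
      exact he.2 v (D.vertex_on_arc e he.1 v h)
  rw [Set.disjoint_left]
  rintro z (⟨v, hv, rfl⟩ | h1) h2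
  · exact disjoint_left.1 h hv (hvert W' v h2)
  · obtain ⟨e, he, hze⟩ := mem_iUnion₂.1 h1
    rcases h2 with ⟨v, hv, rfl⟩ | h2
    · exact disjoint_left.1 h (he.2 v (D.vertex_on_arc e he.1 v hze)) hv
    · obtain ⟨f, hf, hzf⟩ := mem_iUnion₂.1 h2
      by_cases hef : e = f
      · subst hef
        induction e with | _ u v
        have hu := Sym2.mem_mk_left u v
        exact disjoint_left.1 h (he.2 u hu) (hf.2 u hu)
      · obtain ⟨v, hve, hvf, -⟩ := D.arc_inter_arc e he.1 f hf.1 hef z ⟨hze, hzf⟩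
        exact disjoint_left.1 h (he.2 v hve) (hf.2 v hvf)

theorem joinedIn_carrier_of_adj {W : Set V} {u v : V} (huv : G.Adj u v) (hu : u ∈ W)
    (hv : v ∈ W) :
    JoinedIn (D.carrier W {e ∈ G.edgeSet | ∀ v ∈ e, v ∈ W}) (D.point u) (D.point v) := by
  obtain ⟨γ, -, hγ⟩ := D.arc_spec u v huv
  have hW : ∀ w ∈ s(u, v), w ∈ W := by
    intro w hw
    rcases Sym2.mem_iff.1 hw with rfl | rfl
    exacts [hu, hv]
  exact ⟨γ, fun t => arc_subset_carrier (E := {e ∈ G.edgeSet | ∀ v ∈ e, v ∈ W}) ⟨huv, hW⟩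
    (hγ ▸ mem_range_self t)⟩

end PlaneDrawing

theorem card_inter_le_two_of_ne {V : Type*} [DecidableEq V] {ki kj : Finset V}
    (hki : ki.card = 3) (hkj : kj.card = 3) (hne : ki ≠ kj) : (ki ∩ kj).card ≤ 2 := by
  by_contra! h
  have h1 : ki ∩ kj = ki := Finset.eq_of_subset_of_card_le Finset.inter_subset_left (by omega)
  have h2 : ki ∩ kj = kj := Finset.eq_of_subset_of_card_le Finset.inter_subset_right (by omega)
  exact hne (h1.symm.trans h2)

section Triangles

variable {V : Type*} [Fintype V] [DecidableEq V] {G : SimpleGraph V}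

theorem isSeparating_of_forall_adj {K A : Finset V} (hA : A.Nonempty) (hAK : Disjoint A K)
    (hy : ∃ y, y ∉ A ∧ y ∉ K) (h : ∀ u ∈ A, ∀ v, G.Adj u v → v ∈ A ∨ v ∈ K) :
    IsSeparating G K := by
  obtain ⟨y, hyA, hyK⟩ := hy
  refine ⟨A, (A ∪ K)ᶜ, hA, ⟨y, by simp [hyA, hyK]⟩, isDivision_iff.2 ⟨?_, ?_, ?_⟩⟩
  · exact Finset.disjoint_left.2 fun x hx hx' => by simp [hx] at hx'
  · ext x
    have := fun hx : x ∈ A => Finset.disjoint_left.1 hAK hx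
    simp only [Finset.mem_union, Finset.mem_compl]
    tauto
  · intro u hu v hv huv
    have := h u hu v huv
    simp only [Finset.mem_union, Finset.mem_compl] at hv
    tauto

/-- Every connected part which a triangle of a maximal planar graph cuts off is adjacent to all
three vertices, and a third such part would give a drawing of `K₃,₃`. -/
theorem IsMaximalPlanar.not_exists_three_parts (hG : IsMaximalPlanar G) {k : Finset V}
    (hk : G.IsNClique 3 k) (S : Fin 3 → Finset V) (hne : ∀ i, (S i).Nonempty)
    (hdisj : ∀ i j, i ≠ j → Disjoint (S i) (S j)) (hSk : ∀ i, Disjoint (S i) k)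
    (hS : ∀ i, ∀ u ∈ S i, ∀ v, G.Adj u v → v ∈ S i ∨ v ∈ k) : False := by
  classical
  obtain ⟨D⟩ := hG.prop
  choose c hc using hne
  let C : Fin 3 → V → Prop := fun i =>
    Relation.ReflTransGen (fun u w => G.Adj u w ∧ w ∈ S i) (c i)
  have hCS : ∀ i v, C i v → v ∈ S i := by
    intro i v h
    rcases Relation.ReflTransGen.cases_tail h with rfl | ⟨w, -, hw⟩
    exacts [hc i, hw.2]
  -- If the component of `c i` in `S i` missed some `x ∈ k`, its neighbours in `k` would form a
  -- clique `N` with at most two vertices separating it from `x`.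
  have hCk : ∀ i, ∀ x ∈ k, ∃ u, C i u ∧ G.Adj u x := by
    intro i x hx
    by_contra! hcon
    let N : Finset V := k.filter fun x => ∃ u, C i u ∧ G.Adj u x
    have hNk : N ⊆ k := Finset.filter_subset _ _
    have hxN : x ∉ N := fun h => by
      obtain ⟨u, hu, hux⟩ := (Finset.mem_filter.1 h).2
      exact hcon u hu hux
    have hcard : N.card < k.card :=
      Finset.card_lt_card ⟨hNk, fun h => hxN (h hx)⟩
    rw [hk.card_eq] at hcard
    have hSx : ∀ v, v ∈ k → v ∉ S i := fun v hv h => Finset.disjoint_left.1 (hSk i) h hv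
    refine hG.not_isSeparating_of_card_le_two (hk.isClique.subset (Finset.coe_subset.2 hNk))
      (by omega) (isSeparating_of_forall_adj (A := Finset.univ.filter (C i))
        ⟨c i, by simp [C, Relation.ReflTransGen.refl]⟩ ?_ ⟨x, ?_, hxN⟩ ?_)
    · refine Finset.disjoint_left.2 fun v hv hvN => ?_
      exact hSx v (hNk hvN) (hCS i v (Finset.mem_filter.1 hv).2)
    · exact fun h => hSx x hx (hCS i x (Finset.mem_filter.1 h).2)
    · intro u hu v huv
      have huC := (Finset.mem_filter.1 hu).2
      rcases hS i u (hCS i u huC) v huv with h | h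
      · exact Or.inl (Finset.mem_filter.2 ⟨Finset.mem_univ v, huC.tail ⟨huv, h⟩⟩)
      · exact Or.inr (Finset.mem_filter.2 ⟨h, u, huC, huv⟩)
  let x : Fin 3 ≃ k := (k.equivFinOfCardEq hk.card_eq).symm
  -- The connection from `c i` to `x j` runs in the drawing of `S i ∪ {x j}`. Connections with a
  -- common end may overlap, which is why only independent edges are required to be disjoint.
  let W : Fin 3 → Fin 3 → Set V := fun i j => insert (x j : V) (S i)
  refine not_exists_weak_drawing_K33 (fun i => D.point (c i)) (fun j => D.point (x j))
    (fun i j => D.carrier (W i j) {e ∈ G.edgeSet | ∀ v ∈ e, v ∈ W i j}) ?_ ?_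
  · intro i j
    obtain ⟨u, hu, hux⟩ := hCk i (x j) (x j).2
    have hW : ∀ v ∈ S i, v ∈ W i j := fun v hv => mem_insert_of_mem _ hv
    refine JoinedIn.trans ?_ (PlaneDrawing.joinedIn_carrier_of_adj hux (hW u (hCS i u hu))
      (mem_insert _ _))
    clear hux
    induction hu with
    | refl => exact JoinedIn.refl (PlaneDrawing.point_mem_carrier (hW _ (hc i)))
    | @tail v w hv hvw ih =>
      exact ih.trans (PlaneDrawing.joinedIn_carrier_of_adj hvw.1 (hW v (hCS i v hv)) (hW w hvw.2))
  · intro i i' j j' hi hj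
    refine PlaneDrawing.disjoint_carrier (Set.disjoint_left.2 ?_)
    rintro v (rfl | hv) (hv' | hv')
    · exact hj (x.injective (Subtype.ext hv'))
    · exact Finset.disjoint_left.1 (hSk i') hv' (x j).2
    · exact Finset.disjoint_left.1 (hSk i) hv (hv' ▸ (x j').2)
    · exact Finset.disjoint_left.1 (hdisj i i' hi) hv hv'

theorem IsDivision.symm {k S S' : Finset V} (h : IsDivision G k S S') : IsDivision G k S' S := by
  rw [isDivision_iff] at h ⊢
  exact ⟨h.1.symm, by rw [Finset.union_comm]; exact h.2.1,
    fun u hu v hv huv => h.2.2 v hv u hu huv.symm⟩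

theorem IsDivision.mem_or {k S S' : Finset V} (h : IsDivision G k S S') (v : V) :
    v ∈ S ∨ v ∈ S' ∨ v ∈ k := by
  have := h.union_eq
  by_cases hv : v ∈ k
  · exact Or.inr (Or.inr hv)
  · rw [← or_assoc]
    exact Or.inl (Finset.mem_union.1 (this ▸ Finset.mem_compl.2 hv))

theorem IsDivision.disjoint_left {k S S' : Finset V} (h : IsDivision G k S S') :
    Disjoint S k := by
  rw [← Finset.subset_compl_iff_disjoint_right, ← h.union_eq]
  exact Finset.subset_union_left

/-- Each of two non-empty parts into which a triangle divides a maximal planar graph is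
connected. -/
theorem IsMaximalPlanar.subset_or_subset_of_isDivision (hG : IsMaximalPlanar G)
    {k S S' T T' : Finset V} (hk : G.IsNClique 3 k) (hS : IsDivision G k S S') (hS' : S'.Nonempty)
    (hST : S ⊆ T ∪ T') (hTT' : Disjoint T T') (hT : ∀ u ∈ T, ∀ v ∈ T', ¬ G.Adj u v) :
    S ⊆ T ∨ S ⊆ T' := by
  by_contra! hcon
  obtain ⟨y, hyS, hyT⟩ := Finset.not_subset.1 hcon.1
  obtain ⟨x, hxS, hxT⟩ := Finset.not_subset.1 hcon.2
  have hmem : ∀ v ∈ S, v ∈ T ∨ v ∈ T' := fun v hv => Finset.mem_union.1 (hST hv)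
  obtain ⟨hd, -, hadj⟩ := isDivision_iff.1 hS
  have hSk := hS.disjoint_left
  -- If `S` met both `T` and `T'`, the triangle would cut off three parts.
  refine hG.not_exists_three_parts hk ![S ∩ T, S ∩ T', S'] ?_ ?_ ?_ ?_
  · intro i
    fin_cases i
    · exact ⟨x, Finset.mem_inter.2 ⟨hxS, (hmem x hxS).resolve_right hxT⟩⟩
    · exact ⟨y, Finset.mem_inter.2 ⟨hyS, (hmem y hyS).resolve_left hyT⟩⟩
    · exact hS'
  · have h01 : Disjoint (S ∩ T) (S ∩ T') :=
      hTT'.mono Finset.inter_subset_right Finset.inter_subset_right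
    have h02 : Disjoint (S ∩ T) S' := hd.mono_left Finset.inter_subset_left
    have h12 : Disjoint (S ∩ T') S' := hd.mono_left Finset.inter_subset_left
    intro i j hij
    fin_cases i <;> fin_cases j
    exacts [absurd rfl hij, h01, h02, h01.symm, absurd rfl hij, h12, h02.symm, h12.symm,
      absurd rfl hij]
  · intro i
    fin_cases i
    exacts [hSk.mono_left Finset.inter_subset_left, hSk.mono_left Finset.inter_subset_left,
      hS.symm.disjoint_left]
  · have hnb : ∀ u ∈ S, ∀ v, G.Adj u v → v ∈ S ∨ v ∈ k := by
      intro u hu v huv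
      rcases hS.mem_or v with h | h | h
      exacts [Or.inl h, absurd huv (hadj u hu v h), Or.inr h]
    intro i
    fin_cases i
    · intro u hu v huv
      obtain ⟨huS, huT⟩ := Finset.mem_inter.1 hu
      refine (hnb u huS v huv).imp_left fun hv => Finset.mem_inter.2 ⟨hv, ?_⟩
      exact (hmem v hv).resolve_right fun h => hT u huT v h huv
    · intro u hu v huv
      obtain ⟨huS, huT⟩ := Finset.mem_inter.1 hu
      refine (hnb u huS v huv).imp_left fun hv => Finset.mem_inter.2 ⟨hv, ?_⟩
      exact (hmem v hv).resolve_left fun h => hT v h u huT huv.symm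
    · intro u hu v huv
      rcases hS.mem_or v with h | h | h
      exacts [absurd huv.symm (hadj v h u hu), Or.inl h, Or.inr h]

/-! ### Nested and disjoint interiors -/

theorem IsMaximalPlanar.interior_subset_interior (hG : IsMaximalPlanar G)
    {ki kj S S' T T' : Finset V} (hki : G.IsNClique 3 ki) (hkj : G.IsNClique 3 kj)
    (hS : IsInteriorExterior G ki S S') (hT : IsInteriorExterior G kj T T') (hne : ki ≠ kj)
    (h : kj ⊆ ki ∪ S) : kj ∪ T ⊆ ki ∪ S ∧ T ⊆ S := by
  have hnsub : ¬ kj ⊆ ki := fun hsub =>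
    hne (Finset.eq_of_subset_of_card_le hsub (by rw [hki.card_eq, hkj.card_eq])).symm
  have hSne : S.Nonempty := by
    rw [Finset.nonempty_iff_ne_empty]
    rintro rfl
    exact hnsub (by simpa using h)
  have hS'ne : S'.Nonempty := Finset.card_pos.1 ((Finset.card_pos.2 hSne).trans_le hS.card_le)
  obtain ⟨hdS, -, hadjS⟩ := isDivision_iff.1 hS.division
  -- A vertex `x` of `ki \ kj` in `Y` would force all of `ki \ kj` into `Y`, since `ki` is a clique.
  -- Then `S' ⊆ X` would have neighbours outside itself only in `ki ∩ kj`, a separating clique of at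
  -- most two vertices.
  have key : ∀ X Y, IsDivision G kj X Y → S' ⊆ X → ki \ kj ⊆ X := by
    intro X Y hXY hS'X x hx
    obtain ⟨hxi, hxj⟩ := Finset.mem_sdiff.1 hx
    by_contra hxX
    obtain ⟨-, -, hadjX⟩ := isDivision_iff.1 hXY
    have hxY : x ∈ Y := by
      rcases hXY.mem_or x with h | h | h
      exacts [absurd h hxX, h, absurd h hxj]
    have hS'k := hS.division.symm.disjoint_left
    refine hG.not_isSeparating_of_card_le_two (K := ki ∩ kj)
      (hki.isClique.subset (Finset.coe_subset.2 Finset.inter_subset_left))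
      (card_inter_le_two_of_ne hki.card_eq hkj.card_eq hne)
      (isSeparating_of_forall_adj hS'ne (hS'k.mono_right Finset.inter_subset_left)
        ⟨x, fun h => Finset.disjoint_left.1 hS'k h hxi,
          fun h => hxj (Finset.mem_inter.1 h).2⟩ ?_)
    intro u hu v huv
    rcases hS.division.mem_or v with hv | hv | hv
    · exact absurd huv.symm (hadjS v hv u hu)
    · exact Or.inl hv
    · refine Or.inr (Finset.mem_inter.2 ⟨hv, ?_⟩)
      by_contra hvj
      rcases hXY.mem_or v with hvX | hvY | hvj'
      · exact hadjX v hvX x hxY (hki.isClique hv hxi fun h => hxX (h ▸ hvX))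
      · exact hadjX u (hS'X hu) v hvY huv
      · exact hvj hvj'
  obtain ⟨x, hxi, hxj⟩ : ∃ x ∈ ki, x ∉ kj := by
    by_contra! hcon
    exact hne (Finset.eq_of_subset_of_card_le hcon (by rw [hki.card_eq, hkj.card_eq]))
  have key2 : ∀ X Y, IsDivision G kj X Y → S' ⊆ X → Y ⊆ S ∧ S'.card < X.card := by
    intro X Y hXY hS'X
    have hk := key X Y hXY hS'X
    have hdXY := hXY.disjoint
    constructor
    · intro y hy
      rcases hS.division.mem_or y with h | h | h
      · exact h
      · exact absurd hy (Finset.disjoint_left.1 hdXY (hS'X h))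
      · exact absurd hy (Finset.disjoint_left.1 hdXY (hk (Finset.mem_sdiff.2
          ⟨h, Finset.disjoint_left.1 hXY.symm.disjoint_left hy⟩)))
    · refine Finset.card_lt_card ⟨hS'X, fun hXS' => ?_⟩
      exact Finset.disjoint_left.1 hS.division.symm.disjoint_left
        (hXS' (hk (Finset.mem_sdiff.2 ⟨hxi, hxj⟩))) hxi
  obtain ⟨hdT, -, hadjT⟩ := isDivision_iff.1 hT.division
  have hS'T : S' ⊆ T ∪ T' := by
    intro v hv
    rcases hT.division.mem_or v with h' | h' | h'
    · exact Finset.mem_union_left _ h'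
    · exact Finset.mem_union_right _ h'
    · rcases Finset.mem_union.1 (h h') with h'' | h''
      · exact absurd h'' (Finset.disjoint_left.1 hS.division.symm.disjoint_left hv)
      · exact absurd hv (Finset.disjoint_left.1 hdS h'')
  have hTS : T ⊆ S := by
    rcases hG.subset_or_subset_of_isDivision hki hS.division.symm hSne hS'T hdT hadjT with h' | h'
    -- `S' ⊆ T` is impossible: it gives `|T| ≤ |T'| ≤ |S| ≤ |S'| < |T|`.
    · obtain ⟨h1, h2⟩ := key2 T T' hT.division h'
      have := Finset.card_le_card h1
      have := hS.card_le
      have := hT.card_le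
      omega
    · exact (key2 T' T hT.division.symm h').1
  exact ⟨Finset.union_subset h (hTS.trans Finset.subset_union_right), hTS⟩

/-- A vertex of `kj` in `S'` keeps the clique `kj` out of `S`, so `S` lies in one part of `kj`, and
in `T` if it meets `T`. By symmetry `S = T`; the neighbours of this set outside itself lie in both
triangles, so `ki ∩ kj` would separate. -/
theorem IsMaximalPlanar.disjoint_interiors (hG : IsMaximalPlanar G)
    {ki kj S S' T T' : Finset V} (hki : G.IsNClique 3 ki) (hkj : G.IsNClique 3 kj)
    (hS : IsInteriorExterior G ki S S') (hT : IsInteriorExterior G kj T T')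
    (h1 : ¬ kj ⊆ ki ∪ S) (h2 : ¬ ki ⊆ kj ∪ T) : Disjoint S T := by
  have key : ∀ {ki kj S S' T T' : Finset V}, G.IsNClique 3 ki → G.IsNClique 3 kj →
      IsInteriorExterior G ki S S' → IsInteriorExterior G kj T T' → ¬ kj ⊆ ki ∪ S →
      ¬ Disjoint S T → S ⊆ T ∪ T' → S ⊆ T := by
    intro ki kj S S' T T' hki hkj hS hT h1 h2 hST
    obtain ⟨z, hzS, hzT⟩ := Finset.not_disjoint_iff.1 h2
    have hS'ne : S'.Nonempty :=
      Finset.card_pos.1 ((Finset.card_pos.2 ⟨z, hzS⟩).trans_le hS.card_le)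
    obtain ⟨hdT, -, hadjT⟩ := isDivision_iff.1 hT.division
    refine (hG.subset_or_subset_of_isDivision hki hS.division hS'ne hST hdT hadjT).resolve_right
      fun h => Finset.disjoint_left.1 hdT hzT (h hzS)
  have hout : ∀ {ki kj S S' T T' : Finset V}, G.IsNClique 3 kj →
      IsInteriorExterior G ki S S' → IsInteriorExterior G kj T T' → ¬ kj ⊆ ki ∪ S →
      S ⊆ T ∪ T' ∧ ∃ y ∈ S', y ∈ kj := by
    intro ki kj S S' T T' hkj hS hT h1
    obtain ⟨y, hyj, hy⟩ := Finset.not_subset.1 h1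
    obtain ⟨-, -, hadjS⟩ := isDivision_iff.1 hS.division
    have hyS' : y ∈ S' := by
      rcases hS.division.mem_or y with h | h | h
      exacts [absurd (Finset.mem_union_right _ h) hy, h, absurd (Finset.mem_union_left _ h) hy]
    refine ⟨fun v hv => ?_, y, hyS', hyj⟩
    rcases hT.division.mem_or v with h | h | h
    · exact Finset.mem_union_left _ h
    · exact Finset.mem_union_right _ h
    · refine absurd (hkj.isClique h hyj ?_) (hadjS v hv y hyS')
      rintro rfl
      exact Finset.disjoint_left.1 hS.division.disjoint hv hyS'
  by_contra hcon
  obtain ⟨hST, y, hyS', hyj⟩ := hout hkj hS hT h1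
  obtain ⟨hTS, -⟩ := hout hki hT hS h2
  obtain rfl : S = T := Finset.Subset.antisymm (key hki hkj hS hT h1 hcon hST)
    (key hkj hki hT hS h2 (fun h => hcon h.symm) hTS)
  obtain ⟨z, hz, -⟩ := Finset.not_disjoint_iff.1 hcon
  have hne : ki ≠ kj := fun h => h1 (h ▸ Finset.subset_union_left)
  obtain ⟨hdS, -, hadjS⟩ := isDivision_iff.1 hS.division
  obtain ⟨-, -, hadjT⟩ := isDivision_iff.1 hT.division
  refine hG.not_isSeparating_of_card_le_two (K := ki ∩ kj)
    (hki.isClique.subset (Finset.coe_subset.2 Finset.inter_subset_left))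
    (card_inter_le_two_of_ne hki.card_eq hkj.card_eq hne)
    (isSeparating_of_forall_adj ⟨z, hz⟩
      (hS.division.disjoint_left.mono_right Finset.inter_subset_left)
      ⟨y, Finset.disjoint_right.1 hdS hyS', fun h =>
        Finset.disjoint_left.1 hS.division.symm.disjoint_left hyS' (Finset.mem_inter.1 h).1⟩ ?_)
  intro u hu v huv
  rcases hS.division.mem_or v with h | h | h
  · exact Or.inl h
  · exact absurd huv (hadjS u hu v h)
  rcases hT.division.mem_or v with h' | h' | h'
  · exact Or.inl h'
  · exact absurd huv (hadjT u hu v h')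
  · exact Or.inr (Finset.mem_inter.2 ⟨h, h'⟩)

end Triangles

end PlaneTopology

theorem mainTheorem6 {V : Type*} [Fintype V] [DecidableEq V] (G : SimpleGraph V)
    (hG : IsMaximalPlanar G)
    (Gin Gout : Finset V → Finset V)
    (hGin : ∀ k : Finset V, G.IsNClique 3 k → IsInteriorExterior G k (Gin k) (Gout k))
    (ki kj : Finset V) (hki : G.IsNClique 3 ki) (hkj : G.IsNClique 3 kj) :
    (kj ⊆ ki ∪ Gin ki → kj ∪ Gin kj ⊆ ki ∪ Gin ki) ∧
    (ki ⊆ kj ∪ Gin kj → ki ∪ Gin ki ⊆ kj ∪ Gin kj) ∧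
    (¬ kj ⊆ ki ∪ Gin ki → ¬ ki ⊆ kj ∪ Gin kj → Disjoint (Gin ki) (Gin kj)) ∧
    ((kj ∪ Gin kj ⊆ ki ∪ Gin ki ∧ Gin kj ⊆ Gin ki) ∨
      (ki ∪ Gin ki ⊆ kj ∪ Gin kj ∧ Gin ki ⊆ Gin kj) ∨
      Disjoint (Gin ki) (Gin kj)) := by
  have nested : ∀ k l : Finset V, G.IsNClique 3 k → G.IsNClique 3 l → l ⊆ k ∪ Gin k →
      l ∪ Gin l ⊆ k ∪ Gin k ∧ Gin l ⊆ Gin k := by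
    intro k l hk hl h
    rcases eq_or_ne k l with rfl | hne
    · exact ⟨Finset.Subset.refl _, Finset.Subset.refl _⟩
    · exact hG.interior_subset_interior hk hl (hGin k hk) (hGin l hl) hne h
  have hdisj : ¬ kj ⊆ ki ∪ Gin ki → ¬ ki ⊆ kj ∪ Gin kj → Disjoint (Gin ki) (Gin kj) :=
    hG.disjoint_interiors hki hkj (hGin ki hki) (hGin kj hkj)
  refine ⟨fun h => (nested ki kj hki hkj h).1, fun h => (nested kj ki hkj hki h).1, hdisj, ?_⟩
  by_cases h1 : kj ⊆ ki ∪ Gin ki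
  · exact Or.inl (nested ki kj hki hkj h1)
  by_cases h2 : ki ⊆ kj ∪ Gin kj
  · exact Or.inr (Or.inl (nested kj ki hkj hki h2))
  · exact Or.inr (Or.inr (hdisj h1 h2))
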